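/- A quasi-projective manifold is a smooth quasi-projective variety (integral scheme) over $\mathbb{C}$. An SNC compactification of a quasi-projective manifold $U$ is a smooth projective variety $\overline{U}\supset U$ containing $U$ as an open subvariety such that $D_U:=\overline{U}\setminus U$ is a (possibly empty) simple normal crossing divisor. **Lemma 4.5.** Let $f\colon U\to V$ be a finite étale cover between quasi-projective manifolds which is Galois, i.e. $f$ is isomorphic to the quotient map $U\to U/G$ by a finite group $G\subset \mathrm{Aut}(U)$. Let $\overline{U}$ and $\overline{V}$ be any SNC compactifications of $U$ and $V$, with boundary divisors $D_U$ and $D_V$. If $$H^0\big(\overline{U},\mathrm{Sym}^k\Omega_{\overline{U}}(\log D_U)\big)\neq 0\quad\text{for some integer }k>0,$$ then $$H^0\big(\overline{V},\mathrm{Sym}^{m}\Omega_{\overline{V}}(\log D_V)\big)\neq 0\quad\text{for some integer }m>0.$$ -/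

import Mathlib

open AlgebraicGeometry CategoryTheory

namespace LogSym

noncomputable section

/-- The base scheme `Spec ℂ`. -/
abbrev SpecC : Scheme.{0} := Spec (CommRingCat.of ℂ)

/-! ### Projective space, projective and quasi-projective varieties -/

attribute [local instance] MvPolynomial.gradedAlgebra

/-- Projective `n`-space over `ℂ`, as `Proj ℂ[x₀, …, xₙ]` with the grading by degree. -/
def ProjSpace (n : ℕ) : Scheme.{0} :=
  Proj (MvPolynomial.homogeneousSubmodule (Fin (n + 1)) ℂ)

/-- The structure morphism of projective `n`-space over `ℂ`. -/
def ProjSpace.structureMap (n : ℕ) : ProjSpace n ⟶ SpecC :=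
  Proj.toSpecZero (MvPolynomial.homogeneousSubmodule (Fin (n + 1)) ℂ) ≫
    Spec.map (CommRingCat.ofHom
      (algebraMap ℂ (MvPolynomial.homogeneousSubmodule (Fin (n + 1)) ℂ 0)))

/-- A `ℂ`-scheme is projective if it is a closed subscheme of some projective space over `ℂ`. -/
def IsProjective (X : Scheme.{0}) [X.Over SpecC] : Prop :=
  ∃ (n : ℕ) (i : X ⟶ ProjSpace n),
    IsClosedImmersion i ∧ i ≫ ProjSpace.structureMap n = X ↘ SpecC

/-- A `ℂ`-scheme is quasi-projective if it is a locally closed subscheme of some projective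
space over `ℂ`. -/
def IsQuasiProjective (X : Scheme.{0}) [X.Over SpecC] : Prop :=
  ∃ (n : ℕ) (i : X ⟶ ProjSpace n),
    IsImmersion i ∧ i ≫ ProjSpace.structureMap n = X ↘ SpecC

/-- A (complex, connected) quasi-projective manifold: a smooth quasi-projective variety
over `ℂ`. -/
structure IsQuasiProjectiveManifold (X : Scheme.{0}) [X.Over SpecC] : Prop where
  isIntegral : IsIntegral X
  smooth : Smooth (X ↘ SpecC)
  quasiProjective : IsQuasiProjective X

/-! ### Simple normal crossing compactifications -/

/-- The complement `D = X ∖ U` of the open set `U` is a simple normal crossing divisor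
(possibly empty): at each point `x` there is a regular system of parameters `z₁, …, z_d` of the
local ring at `x` such that `D` is given near `x` by the equation `∏_{i ∈ s} z i = 0`.
(The points of `Spec 𝒪_{X,x}` are the points of `X` specializing to `x`; the parameters live in
the Zariski local ring, so that self-intersections of components are excluded.) -/
def HasSNCComplement {X : Scheme.{0}} (U : X.Opens) : Prop :=
  ∀ x : X, ∃ (d : ℕ) (z : Fin d → X.presheaf.stalk x) (s : Finset (Fin d)),
    ringKrullDim (X.presheaf.stalk x) = d ∧
    Ideal.span (Set.range z) = IsLocalRing.maximalIdeal (X.presheaf.stalk x) ∧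
    ∀ p : Spec (X.presheaf.stalk x),
      X.fromSpecStalk x p ∈ U ↔ ∀ i ∈ s, z i ∉ p.asIdeal

/-- `j : U ⟶ X` exhibits `X` as a smooth projective compactification of `U` whose boundary
`X ∖ U` is a simple normal crossing divisor (the variety `X` is integral and `j` is an open
immersion by the instance arguments). -/
structure IsSNCCompactification {U X : Scheme.{0}} [U.Over SpecC] [X.Over SpecC] [IsIntegral X]
    (j : U ⟶ X) [IsOpenImmersion j] : Prop where
  isOver : j.IsOver SpecC
  smooth : Smooth (X ↘ SpecC)
  projective : IsProjective X
  snc : HasSNCComplement (j.opensRange)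

/-! ### Logarithmic symmetric forms

Throughout, `X` is an integral `ℂ`-scheme with function field `K`, and `U` is the complement of
the boundary `D`. When `X` is smooth and `D` is a simple normal crossing divisor, the sheaf
`Symᵏ Ω_X(log D)` is locally free, hence is the subsheaf of the constant sheaf
`Symᵏ_K Ω_{K/ℂ}` (its generic stalk) with the stalks described below. -/

/-- The function field of a `ℂ`-scheme is an extension of `ℂ`, through the structure
morphism. -/
instance functionFieldAlgebra (X : Scheme.{0}) [X.Over SpecC] [IrreducibleSpace X] :
    Algebra ℂ X.functionField :=
  ((X.presheaf.germ ⊤ (genericPoint X) trivial).hom.comp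
    ((X ↘ SpecC).appTop.hom.comp (Scheme.ΓSpecIso (CommRingCat.of ℂ)).inv.hom)).toAlgebra

section

variable (X : Scheme.{0}) [X.Over SpecC] [IsIntegral X]

/-- The space `Ω_{K/ℂ}` of rational differential forms on `X`. -/
abbrev RatForm : Type := Ω[X.functionField⁄ℂ]

/-- The symmetric algebra `⨁ₖ Symᵏ_K Ω_{K/ℂ}` of rational symmetric forms on `X`. -/
abbrev RatSymForm : Type := SymmetricAlgebra X.functionField (RatForm X)

variable {X}

/-- The local ring `𝒪_{X,x}`, as a subring of the function field. -/
def localRing (x : X) : Subring X.functionField :=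
  (algebraMap (X.presheaf.stalk x) X.functionField).range

/-- The nonzero germs of regular functions at `x` that are invertible on `U` near `x`, i.e. in
the local ring of every point of `U` that specializes to `x`. -/
def logUnits (U : X.Opens) (x : X) : Set X.functionField :=
  {u | u ≠ 0 ∧ u ∈ localRing x ∧ ∀ y : X, y ⤳ x → y ∈ U → u⁻¹ ∈ localRing y}

/-- The stalk at `x` of `Ω_X(log D)`, where `D = X ∖ U`: the `𝒪_{X,x}`-module generated by the
differentials `dz` of the regular functions `z` at `x`, and by the logarithmic differentials
`du / u` of the regular functions `u` at `x` that vanish at most along `D`. -/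
def logFormsAt (U : X.Opens) (x : X) : Submodule (localRing x) (RatForm X) :=
  Submodule.span (localRing x)
    ({ω | ∃ z ∈ localRing x, ω = KaehlerDifferential.D ℂ X.functionField z} ∪
     {ω | ∃ u ∈ logUnits U x, ω = u⁻¹ • KaehlerDifferential.D ℂ X.functionField u})

/-- The stalk at `x` of `Symᵏ Ω_X(log D)`: the `𝒪_{X,x}`-module generated by the `k`-fold
symmetric products of germs of logarithmic forms. -/
def logSymFormsAt (U : X.Opens) (k : ℕ) (x : X) : Submodule (localRing x) (RatSymForm X) :=
  Submodule.span (localRing x)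
    {σ | ∃ ω : Fin k → RatForm X, (∀ i, ω i ∈ logFormsAt U x) ∧
      σ = ∏ i, SymmetricAlgebra.ι X.functionField (RatForm X) (ω i)}

/-- The sections of `Symᵏ Ω_X(log D)`, `D = X ∖ U`, over an open set `W`. -/
def logSymForms (U : X.Opens) (k : ℕ) (W : X.Opens) : AddSubgroup (RatSymForm X) :=
  ⨅ x ∈ W, (logSymFormsAt U k x).toAddSubgroup

/-- `H⁰(X, Symᵏ Ω_X(log D)) ≠ 0`, where `D = X ∖ U`. -/
def HasNonzeroLogSymForm (U : X.Opens) (k : ℕ) : Prop :=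
  ∃ σ ∈ logSymForms U k ⊤, σ ≠ 0

end

/-! ### Galois covers -/

/-- `f : U ⟶ V` is the quotient map of `U` by the group `G` of automorphisms: it is invariant,
it is a topological quotient map whose fibres are the orbits of `G`, and the regular functions
on `V` are the `G`-invariant regular functions on `U`. -/
structure IsQuotientBy {U V : Scheme.{0}} (G : Subgroup (Aut U)) (f : U ⟶ V) : Prop where
  invariant : ∀ g ∈ G, g.hom ≫ f = f
  isQuotientMap : Topology.IsQuotientMap f
  orbits : ∀ x y : U, f x = f y → ∃ g ∈ G, g.hom x = y
  sections : ∀ (W : V.Opens) (s : Γ(U, f ⁻¹ᵁ W)),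
    (∀ (g : Aut U) (hg : g ∈ G), g.hom.appLE (f ⁻¹ᵁ W) (f ⁻¹ᵁ W)
      (by rw [← Scheme.Hom.comp_preimage, invariant g hg]) s = s) →
    ∃! t : Γ(V, W), f.app W t = s

/-- `f : U ⟶ V` is a Galois cover: it is the quotient map by some finite group of
automorphisms of `U`. -/
def IsGaloisCover {U V : Scheme.{0}} (f : U ⟶ V) : Prop :=
  ∃ G : Subgroup (Aut U), Finite G ∧ IsQuotientBy G f

end

end LogSym

open LogSym

/-! Let `K ⊆ L` be the function fields of `Y` and `X`. They are those of `V` and `U`, so `G` acts on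
`L` with fixed field `K`. The extension is finite and separable, hence `Ω_L = L ⊗ Ω_K`, and in a
basis coming from `K` the group acts on symmetric forms through their coefficients. The product `τ`
of the conjugates of `σ` is therefore a nonzero symmetric form over `K`, of degree `|G| * k`. The
point is that `τ` has no poles on `Y` as a logarithmic form
(`LogSym.coeff_mem_localRing_of_map_eq_prod`).

At `y`, a regular system of parameters adapted to the boundary gives a basis `e` of logarithmic
forms (`IsLocalRing.exists_basis_log`), and the coefficients of `τ` in `e` must lie in the local
ring. The boundary equations are prime elements, so it suffices to exclude poles off the boundary
and along each boundary component (`IsFractionRing.exists_algebraMap_eq_of_prime`).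

Off the boundary, the cover is étale: the derivations dual to `e` preserve the local rings of `U`,
and faithful flatness brings regularity back to `V`.

Along a component `z = 0`, the map `U ⟶ V` need not extend to `X ⟶ Y`, and valuations replace such
an extension. Some valuation ring `B` of `L` above the local ring at `z` satisfies `δ b / b ∈ B` for
the derivations `δ` dual to `e`; this is tameness of ramification in characteristic zero
(`Prime.exists_valuationSubring_derivation_div_mem`). Each conjugate of `B` has a center on the
projective variety `X`, and `σ` is a logarithmic form there. Logarithmic forms at the center have
coefficients in the conjugate of `B`, whatever the boundary looks like
(`LogSym.algEquiv_coeff_mem_valuationSubring`). So the coefficients of `τ` lie in `B ∩ K`, the local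
ring at `z`. -/

/-! ### Logarithmic derivations and tame ramification -/

theorem Derivation.exists_apply_aeval_eq {k A L : Type*} [CommRing k] [CommRing A] [CommRing L]
    [Algebra k L] [Algebra A L] (δ : Derivation k L L) (S : Subring L)
    (hδ : ∀ a : A, δ (algebraMap A L a) ∈ S)
    {x : L} (hx : x ∈ S) (F : Polynomial A) :
    ∃ c ∈ S, δ (Polynomial.aeval x F) = c + Polynomial.aeval x F.derivative * δ x := by
  induction F using Polynomial.induction_on' with
  | add p q hp hq =>
    obtain ⟨c, hc, hp⟩ := hp
    obtain ⟨d, hd, hq⟩ := hq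
    exact ⟨c + d, add_mem hc hd, by simp only [map_add, hp, hq]; ring⟩
  | monomial n a =>
    -- This is the Leibniz term in which `δ` falls on the coefficient; the other term is the formal
    -- derivative.
    refine ⟨x ^ n * δ (algebraMap A L a), mul_mem (pow_mem hx n) (hδ a), ?_⟩
    simp only [Polynomial.aeval_monomial, Derivation.leibniz, Derivation.leibniz_pow, smul_eq_mul,
      Polynomial.derivative_monomial, map_mul, _root_.map_natCast, nsmul_eq_mul]
    ring

/-- An element of an extension of a `ℚ`-algebra that is integral modulo a prime ideal is a simple
root, modulo this prime ideal, of some polynomial. -/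
theorem Polynomial.exists_aeval_mem_derivative_notMem {A B : Type*} [CommRing A] [CommRing B]
    [Algebra ℚ A] [Algebra A B] (P : Ideal B) [P.IsPrime] {x : B} (hx : IsIntegral A x) :
    ∃ F : Polynomial A, aeval x F ∈ P ∧ aeval x F.derivative ∉ P := by
  classical
  -- Take `F` monic of least degree with `F(x) ∈ P`. Were `F'(x)` in `P` too, `F' / deg F` would be
  -- monic of smaller degree with value in `P`.
  have hex : ∃ n, ∃ F : Polynomial A, F.Monic ∧ F.natDegree = n ∧ aeval x F ∈ P := by
    obtain ⟨F, hF, hF0⟩ := hx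
    exact ⟨_, F, hF, rfl, by rw [aeval_def, hF0]; exact P.zero_mem⟩
  obtain ⟨F, hF, hdeg, hFP⟩ := Nat.find_spec hex
  refine ⟨F, hFP, fun hd ↦ ?_⟩
  have hntA : Nontrivial A := by
    by_contra h
    rw [not_nontrivial_iff_subsingleton] at h
    have : (1 : B) = 0 := by rw [← map_one (algebraMap A B), Subsingleton.elim (1 : A) 0, map_zero]
    exact Ideal.IsPrime.ne_top ‹_› ((Ideal.eq_top_iff_one P).mpr (this ▸ P.zero_mem))
  have hn0 : F.natDegree ≠ 0 := by
    intro h0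
    rw [hF.natDegree_eq_zero.mp h0, map_one] at hFP
    exact Ideal.IsPrime.ne_top ‹_› ((Ideal.eq_top_iff_one P).mpr hFP)
  obtain ⟨m, hm⟩ := Nat.exists_eq_succ_of_ne_zero hn0
  let q : A := algebraMap ℚ A ((m : ℚ) + 1)⁻¹
  have hq : q * ((m : A) + 1) = 1 := by
    have h1 : algebraMap ℚ A ((m : ℚ) + 1) = (m : A) + 1 := by simp
    rw [← h1, ← map_mul, inv_mul_cancel₀ (by positivity), map_one]
  have hcoeff : (C q * F.derivative).coeff m = 1 := by
    rw [coeff_C_mul, coeff_derivative, ← Nat.succ_eq_add_one, ← hm, hF.coeff_natDegree, one_mul, hq]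
  have hle : (C q * F.derivative).natDegree ≤ m :=
    (natDegree_C_mul_le _ _).trans ((natDegree_derivative_le F).trans (by omega))
  have hmonic : (C q * F.derivative).Monic := monic_of_natDegree_le_of_coeff_eq_one m hle hcoeff
  refine Nat.find_min hex (m := (C q * F.derivative).natDegree) (by omega)
    ⟨_, hmonic, rfl, ?_⟩
  rw [map_mul]
  exact P.mul_mem_left _ hd

theorem Derivation.apply_mul_div {k L : Type*} [CommRing k] [Field L] [Algebra k L]
    (δ : Derivation k L L) {x y : L} (hx : x ≠ 0) (hy : y ≠ 0) :
    δ (x * y) / (x * y) = δ x / x + δ y / y := by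
  rw [Derivation.leibniz, smul_eq_mul, smul_eq_mul]
  field_simp
  ring

theorem Derivation.apply_pow_div {k L : Type*} [CommRing k] [Field L] [Algebra k L]
    (δ : Derivation k L L) {x : L} (hx : x ≠ 0) (n : ℕ) :
    δ (x ^ n) / x ^ n = n * (δ x / x) := by
  induction n with
  | zero => simp
  | succ n ih =>
    rw [pow_succ, δ.apply_mul_div (pow_ne_zero n hx) hx, ih]
    push_cast
    ring

/-- A derivation with poles of bounded order on a discrete valuation ring `R` above a ring `A` is
logarithmic on `R` as soon as it preserves `A` and is logarithmic at a non-unit `t` of `A`. -/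
theorem Derivation.div_mem_of_bounded {k A L : Type*} [CommRing k] [CommRing A] [Field L]
    [Algebra k L] [Algebra A L] [Algebra ℚ A] (R : Subring L) {π : L}
    (hπR : π ∈ R) (hπ0 : π ≠ 0)
    (hdvr : ∀ b ∈ R, b ≠ 0 → ∃ (n : ℕ) (u : L), u ∈ R ∧ u⁻¹ ∈ R ∧ u ≠ 0 ∧ b = π ^ n * u)
    (hAR : ∀ a : A, algebraMap A L a ∈ R) (t : A) (ht0 : algebraMap A L t ≠ 0)
    (ht : (algebraMap A L t)⁻¹ ∉ R)
    (T : Set L) (hT : ∀ x ∈ T, x ∈ R ∧ x⁻¹ ∈ R ∧ x ≠ 0 ∧ ∃ F : Polynomial A,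
      Polynomial.aeval x F / π ∈ R ∧ Polynomial.aeval x F.derivative ≠ 0 ∧
        (Polynomial.aeval x F.derivative)⁻¹ ∈ R)
    (hunit : ∀ u ∈ R, u⁻¹ ∈ R → u ≠ 0 → ∃ x ∈ T, ∃ y ∈ T, u = x / y)
    (δ : Derivation k L L) (hδA : ∀ a : A, δ (algebraMap A L a) ∈ R)
    (hδt : δ (algebraMap A L t) / algebraMap A L t ∈ R)
    (hbdd : ∃ d ∈ R, d ≠ 0 ∧ ∀ b ∈ R, d * δ b ∈ R) :
    ∀ b ∈ R, b ≠ 0 → δ b / b ∈ R := by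
  classical
  -- If `d` has order `n`, then `π ^ n * δ` preserves `R`; one more factor `π` absorbs the
  -- denominator of `δ π / π`.
  have hex : ∃ n, ∀ b ∈ R, b ≠ 0 → π ^ n * (δ b / b) ∈ R := by
    obtain ⟨d, hd, hd0, hdR⟩ := hbdd
    obtain ⟨n, u, hu, hui, hu0, rfl⟩ := hdvr d hd hd0
    have key : ∀ b ∈ R, π ^ n * δ b ∈ R := fun b hb ↦ by
      have := mul_mem hui (hdR b hb)
      convert this using 1
      field_simp
    refine ⟨n + 1, fun b hb hb0 ↦ ?_⟩
    obtain ⟨m, v, hv, hvi, hv0, rfl⟩ := hdvr b hb hb0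
    rw [δ.apply_mul_div (pow_ne_zero m hπ0) hv0, δ.apply_pow_div hπ0, mul_add]
    refine add_mem ?_ ?_
    · convert mul_mem (natCast_mem R m) (key π hπR) using 1
      field_simp
      ring
    · convert mul_mem (mul_mem hπR hvi) (key v hv) using 1
      field_simp
      ring
  -- The least pole order is zero: a bound `m + 1` always improves to `m`.
  suffices h : Nat.find hex = 0 by
    have := Nat.find_spec hex
    rw [h] at this
    simpa using this
  by_contra hne
  obtain ⟨m, hm⟩ := Nat.exists_eq_succ_of_ne_zero hne
  have hspec := Nat.find_spec hex
  rw [hm] at hspec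
  refine Nat.find_min hex (m := m) (by omega) ?_
  -- Since `F(x)` is divisible by `π`, the bound `m + 1` on its logarithmic derivative gives the
  -- bound `m` on `δ (F(x))`. As `F'(x)` is a unit, the chain rule passes this on to `δ x`.
  have hsimple : ∀ x ∈ T, π ^ m * (δ x / x) ∈ R := by
    intro x hxT
    obtain ⟨hx, hxi, hx0, F, hF, hF0, hFi⟩ := hT x hxT
    obtain ⟨c, hc, hcF⟩ := δ.exists_apply_aeval_eq R hδA hx F
    have h1 : π ^ m * δ (Polynomial.aeval x F) ∈ R := by
      by_cases hz : Polynomial.aeval x F = 0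
      · simp [hz]
      · have hzR : Polynomial.aeval x F ∈ R := by
          convert mul_mem hπR hF using 1
          field_simp
        convert mul_mem (hspec _ hzR hz) hF using 1
        field_simp
        rw [pow_succ]
        ring
    have h2 : π ^ m * (Polynomial.aeval x F.derivative * δ x) ∈ R := by
      convert sub_mem h1 (mul_mem (pow_mem hπR m) hc) using 1
      rw [hcF]; ring
    convert mul_mem (mul_mem h2 hFi) hxi using 1
    field_simp
  have hu : ∀ u ∈ R, u⁻¹ ∈ R → u ≠ 0 → π ^ m * (δ u / u) ∈ R := by
    intro u hu hui hu0
    obtain ⟨x, hx, y, hy, rfl⟩ := hunit u hu hui hu0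
    have hy0 := (hT y hy).2.2.1
    have h := δ.apply_mul_div hu0 hy0
    rw [div_mul_cancel₀ _ hy0] at h
    rw [← sub_eq_iff_eq_add.mpr h, mul_sub]
    exact sub_mem (hsimple x hx) (hsimple y hy)
  -- With `t = π ^ e * u`, one has `δ t / t = e * (δ π / π) + δ u / u`. The ramification index `e`
  -- is nonzero because `t` is not a unit, and invertible because `A` contains `ℚ`.
  have hπ : π ^ m * (δ π / π) ∈ R := by
    obtain ⟨e, u, huR, hui, hu0, hte⟩ := hdvr _ (hAR t) ht0
    have he : e ≠ 0 := by
      rintro rfl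
      rw [pow_zero, one_mul] at hte
      exact ht (hte ▸ hui)
    have h1 : (e : L) * (π ^ m * (δ π / π)) ∈ R := by
      have h := δ.apply_mul_div (pow_ne_zero e hπ0) hu0
      rw [← hte, δ.apply_pow_div hπ0] at h
      have h2 := sub_mem (mul_mem (pow_mem hπR m) hδt) (hu u huR hui hu0)
      rw [h] at h2
      convert h2 using 1
      ring
    have hinv : algebraMap A L (algebraMap ℚ A ((e : ℚ)⁻¹)) * (e : L) = 1 := by
      rw [← _root_.map_natCast (algebraMap A L), ← map_mul, ← _root_.map_natCast (algebraMap ℚ A),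
        ← map_mul,
        inv_mul_cancel₀ (by exact_mod_cast he), map_one, map_one]
    convert mul_mem (hAR (algebraMap ℚ A ((e : ℚ)⁻¹))) h1 using 1
    rw [← mul_assoc, hinv, one_mul]
  intro b hb hb0
  obtain ⟨n, u, huR, hui, hu0, rfl⟩ := hdvr b hb hb0
  rw [δ.apply_mul_div (pow_ne_zero n hπ0) hu0, δ.apply_pow_div hπ0, mul_add]
  refine add_mem ?_ (hu u huR hui hu0)
  convert mul_mem (natCast_mem R n) hπ using 1
  ring

/-- One `d` makes the values of `δ` on finitely many generators of `C` integral over `A`, hence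
elements of `C`. The Leibniz rule extends this to all of `C`, since `δ` preserves `A`. This provides
the initial bound on the poles of `δ`. -/
theorem Derivation.exists_mul_mem_of_finite {k A C L : Type*} [CommRing k] [CommRing A]
    [CommRing C] [Field L] [Algebra k L] [Algebra A C] [Algebra C L] [Algebra A L]
    [IsScalarTower A C L] [IsDomain A] [FaithfulSMul A L] [IsIntegralClosure C A L]
    [Algebra.IsAlgebraic A L] [Module.Finite A C] (δ : Derivation k L L)
    (hδ : ∀ a : A, ∃ a' : A, δ (algebraMap A L a) = algebraMap A L a') :
    ∃ d : A, d ≠ 0 ∧ ∀ x : C, ∃ c : C, algebraMap A L d * δ (algebraMap C L x) = algebraMap C L c := by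
  classical
  obtain ⟨s, hs⟩ := Module.Finite.fg_top (R := A) (M := C)
  obtain ⟨d, hd0, hd⟩ := Algebra.IsAlgebraic.exists_integral_multiples A
    (s.image fun x ↦ δ (algebraMap C L x))
  refine ⟨d, hd0, fun x ↦ ?_⟩
  have hx : x ∈ Submodule.span A (s : Set C) := hs ▸ Submodule.mem_top
  induction hx using Submodule.span_induction with
  | mem x hx =>
    have hi := hd (δ (algebraMap C L x)) (Finset.mem_image_of_mem _ hx)
    exact ⟨IsIntegralClosure.mk' C _ hi, by
      rw [IsIntegralClosure.algebraMap_mk', Algebra.smul_def]⟩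
  | zero => exact ⟨0, by simp⟩
  | add x y _ _ hx hy =>
    obtain ⟨c, hc⟩ := hx
    obtain ⟨c', hc'⟩ := hy
    exact ⟨c + c', by simp only [map_add, mul_add, hc, hc']⟩
  | smul a x _ hx =>
    obtain ⟨c, hc⟩ := hx
    obtain ⟨a', ha'⟩ := hδ a
    refine ⟨a • c + (d * a') • x, ?_⟩
    simp only [Algebra.smul_def, map_mul, map_add, Derivation.leibniz, ← hc,
      ← IsScalarTower.algebraMap_apply A C L, ha', Algebra.algebraMap_self, RingHom.id_apply]
    ring

/-- Let `L / K` be a finite extension of the field of fractions of a discrete valuation ring `A` of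
equal characteristic zero. Some valuation ring `B` of `L` lies above `A` and is such that every
derivation of `L` that is logarithmic on `A` is logarithmic on `B`. -/
theorem IsDiscreteValuationRing.exists_valuationSubring_derivation_div_mem
    (k A K L : Type*) [CommRing k] [CommRing A] [IsDomain A] [IsDiscreteValuationRing A]
    [Algebra ℚ A] [Field K] [Field L] [Algebra k L] [Algebra A K] [IsFractionRing A K]
    [Algebra K L] [Algebra A L] [IsScalarTower A K L] [FiniteDimensional K L]
    [Algebra.IsSeparable K L] {t : A} (ht : Irreducible t) :
    ∃ B : ValuationSubring L, (∀ a : A, algebraMap A L a ∈ B) ∧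
      (∀ c : K, algebraMap K L c ∈ B → ∃ a : A, algebraMap A K a = c) ∧
      ∀ δ : Derivation k L L, (∀ a : A, ∃ a' : A, δ (algebraMap A L a) = algebraMap A L a') →
        (∃ a' : A, δ (algebraMap A L t) = algebraMap A L (t * a')) →
        ∀ b ∈ B, b ≠ 0 → δ b / b ∈ B := by
  have hAKinj := IsFractionRing.injective A K
  have hALinj : Function.Injective (algebraMap A L) := by
    rw [IsScalarTower.algebraMap_eq A K L]
    exact (algebraMap K L).injective.comp hAKinj
  have : FaithfulSMul A L := (faithfulSMul_iff_algebraMap_injective A L).mpr hALinj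
  have := IsLocalization.isAlgebraic K (nonZeroDivisors A)
  have : Algebra.IsAlgebraic A L := Algebra.IsAlgebraic.trans A K L
  let C := integralClosure A L
  have hDed : IsDedekindDomain C := integralClosure.isDedekindDomain A K L
  have hfin : Module.Finite A C := IsIntegralClosure.finite A K L C
  have hfrac : IsFractionRing C L := integralClosure.isFractionRing_of_finite_extension K L
  have hint : Algebra.IsIntegral A C := IsIntegralClosure.isIntegral_algebra A L
  have hCL : ∀ a : A, algebraMap C L (algebraMap A C a) = algebraMap A L a := fun a ↦ rfl
  have hCLinj : Function.Injective (algebraMap C L) := IsFractionRing.injective C L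
  -- Any maximal ideal of the integral closure will do: it lies above that of `A`, and the
  -- localization there is the discrete valuation ring sought.
  obtain ⟨P, hPmax⟩ := Ideal.exists_maximal C
  have hcomap : P.comap (algebraMap A C) = IsLocalRing.maximalIdeal A :=
    IsLocalRing.eq_maximalIdeal (Ideal.isMaximal_comap_of_isIntegral_of_isMaximal P)
  have htP : algebraMap A C t ∈ P := by
    rw [← Ideal.mem_comap, hcomap]
    exact ht.not_isUnit
  have ht0 : algebraMap A L t ≠ 0 := (map_ne_zero_iff _ hALinj).mpr ht.ne_zero
  have hPbot : P ≠ ⊥ := by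
    rintro rfl
    apply ht0
    rw [← hCL, Ideal.mem_bot.mp htP, map_zero]
  let R' := Localization.subalgebra.ofField L P.primeCompl P.primeCompl_le_nonZeroDivisors
  have hloc : IsLocalization.AtPrime R' P := Localization.subalgebra.isLocalization_ofField ..
  have hdvr : IsDiscreteValuationRing R' :=
    IsLocalization.AtPrime.isDiscreteValuationRing_of_dedekind_domain C hPbot R'
  have hfrac' : IsFractionRing R' L := Localization.subalgebra.isFractionRing_ofField ..
  have hmem : ∀ x : L, x ∈ R' ↔ ∃ (a s : C) (_ : s ∈ P.primeCompl),
    x = algebraMap C L a * (algebraMap C L s)⁻¹ := fun _ ↦ Iff.rfl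
  have hCR : ∀ c : C, algebraMap C L c ∈ R' := fun c ↦ R'.algebraMap_mem c
  have hCu : ∀ c : C, c ∉ P → (algebraMap C L c)⁻¹ ∈ R' := fun c hc ↦
    (hmem _).mpr ⟨1, c, hc, by simp⟩
  have hCu' : ∀ c : C, c ∈ P → (algebraMap C L c)⁻¹ ∈ R' → algebraMap C L c = 0 := by
    rintro c hc h
    by_contra h0
    obtain ⟨a, s, hs, has⟩ := (hmem _).mp h
    have hs0 : algebraMap C L s ≠ 0 := by
      rw [map_ne_zero_iff _ hCLinj]
      rintro rfl
      exact hs P.zero_mem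
    have : s = a * c := by
      apply hCLinj
      rw [map_mul]
      field_simp at has
      linear_combination has
    exact hs (this ▸ P.mul_mem_left a hc)
  have hval : ∀ x : L, x ∈ R' ∨ x⁻¹ ∈ R' := by
    intro x
    rcases ValuationRing.isInteger_or_isInteger R' x with ⟨y, hy⟩ | ⟨y, hy⟩
    · exact .inl (hy ▸ y.2)
    · exact .inr (hy ▸ y.2)
  let B : ValuationSubring L := { R'.toSubring with mem_or_inv_mem' := hval }
  have hAB : ∀ a : A, algebraMap A L a ∈ R' := fun a ↦ hCR (algebraMap A C a)
  refine ⟨B, hAB, ?_, ?_⟩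
  -- If `c⁻¹` comes from a nonunit of `A`, this nonunit lies in `P`, yet its inverse is in `R'`;
  -- this forces `c = 0`.
  · intro c hc
    rcases ValuationRing.isInteger_or_isInteger A c with ⟨a, ha⟩ | ⟨a, ha⟩
    · exact ⟨a, ha⟩
    · by_cases hu : IsUnit a
      · obtain ⟨u, rfl⟩ := hu
        refine ⟨(u⁻¹ : Aˣ), ?_⟩
        rw [← inv_inv c, ← ha, ← map_units_inv]
      · have h0 : c = 0 := by
          have haP : algebraMap A C a ∈ P := by
            rw [← Ideal.mem_comap, hcomap]
            exact hu
          have hca : algebraMap C L (algebraMap A C a) = (algebraMap K L c)⁻¹ := by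
            rw [hCL, IsScalarTower.algebraMap_apply A K L, ha, map_inv₀]
          have := hCu' _ haP (by rw [hca, inv_inv]; exact hc)
          rw [hca, inv_eq_zero, map_eq_zero] at this
          exact this
        exact ⟨0, by rw [h0, map_zero]⟩
  · intro δ hδ hδt
    obtain ⟨π, hπ⟩ := IsDiscreteValuationRing.exists_irreducible R'
    have hπ0 : (π : L) ≠ 0 := fun h ↦ hπ.ne_zero (Subtype.ext h)
    have hnotunit : ∀ c : C, c ∈ P → algebraMap C L c / π ∈ R' := by
      intro c hc
      by_cases h0 : algebraMap C L c = 0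
      · rw [h0, zero_div]; exact R'.zero_mem
      have : algebraMap C R' c ∈ IsLocalRing.maximalIdeal R' := by
        intro hu
        obtain ⟨u, hu⟩ := hu
        apply h0
        apply hCu' c hc
        have h1 : ((u : R') : L) * ((u⁻¹ : R'ˣ) : R') = 1 := by
          rw [← MulMemClass.coe_mul, Units.mul_inv]; rfl
        have h2 : ((u : R') : L) = algebraMap C L c := by rw [hu]; rfl
        rw [h2] at h1
        rw [inv_eq_of_mul_eq_one_right h1]
        exact Subtype.property _
      rw [hπ.maximalIdeal_eq, Ideal.mem_span_singleton] at this
      obtain ⟨q, hq⟩ := this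
      have h2 : algebraMap C L c = π * q := congrArg Subtype.val hq
      rw [h2, mul_div_cancel_left₀ _ hπ0]
      exact q.2
    -- The test set `T` is the image of `C ∖ P`: its quotients exhaust the units of `R'`, and its
    -- members, being integral over `A`, are simple roots modulo `P`.
    refine δ.div_mem_of_bounded R'.toSubring (A := A) π.2 hπ0 ?_ hAB t ht0 ?_
      {x | ∃ c : C, c ∉ P ∧ algebraMap C L c = x} ?_ ?_ ?_ ?_ ?_
    · intro b hb hb0
      obtain ⟨n, u, hu⟩ := IsDiscreteValuationRing.associated_pow_irreducible
        (x := (⟨b, hb⟩ : R')) (fun h ↦ hb0 (congrArg Subtype.val h)) hπ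
      have h1 : ((u : R') : L) * ((u⁻¹ : R'ˣ) : R') = 1 := by
        rw [← MulMemClass.coe_mul, Units.mul_inv]; rfl
      have h2 : b * ((u : R') : L) = π ^ n := congrArg Subtype.val hu
      refine ⟨n, ((u⁻¹ : R'ˣ) : R'), Subtype.property _, ?_, right_ne_zero_of_mul_eq_one h1, ?_⟩
      · rw [inv_eq_of_mul_eq_one_left h1]
        exact Subtype.property _
      · rw [← h2, mul_assoc, h1, mul_one]
    · intro h
      exact ht0 (hCu' _ htP h)
    · rintro _ ⟨c, hc, rfl⟩
      refine ⟨hCR c, hCu c hc, ?_, ?_⟩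
      · rw [map_ne_zero_iff _ hCLinj]
        rintro rfl
        exact hc P.zero_mem
      · obtain ⟨F, hF, hF'⟩ := Polynomial.exists_aeval_mem_derivative_notMem P (hint.isIntegral c)
        refine ⟨F, ?_, ?_, ?_⟩
        · rw [Polynomial.aeval_algebraMap_apply]
          exact hnotunit _ hF
        · rw [Polynomial.aeval_algebraMap_apply, map_ne_zero_iff _ hCLinj]
          intro h
          exact hF' (h ▸ P.zero_mem)
        · rw [Polynomial.aeval_algebraMap_apply]
          exact hCu _ hF'
    · intro u hu hui hu0
      obtain ⟨a, s, hs, rfl⟩ := (hmem _).mp hu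
      refine ⟨_, ⟨a, fun ha ↦ ?_, rfl⟩, _, ⟨s, hs, rfl⟩, (div_eq_mul_inv _ _).symm⟩
      have ha0 : algebraMap C L a ≠ 0 := left_ne_zero_of_mul hu0
      refine ha0 (hCu' a ha ?_)
      have hs0 : algebraMap C L s ≠ 0 := fun h ↦ hu0 (by rw [h, inv_zero, mul_zero])
      have h1 : (algebraMap C L a)⁻¹ =
          (algebraMap C L a * (algebraMap C L s)⁻¹)⁻¹ * (algebraMap C L s)⁻¹ := by
        field_simp
      exact h1 ▸ R'.mul_mem hui (hCu s hs)
    · intro a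
      obtain ⟨a', ha'⟩ := hδ a
      rw [ha']
      exact hAB a'
    · obtain ⟨a', ha'⟩ := hδt
      rw [ha', map_mul, mul_div_cancel_left₀ _ ht0]
      exact hAB a'
    · obtain ⟨d, hd0, hd⟩ := δ.exists_mul_mem_of_finite (C := C) hδ
      refine ⟨algebraMap A L d, hAB d, (map_ne_zero_iff _ hALinj).mpr hd0, ?_⟩
      intro b hb
      obtain ⟨a, s, hs, rfl⟩ := (hmem _).mp hb
      obtain ⟨c, hc⟩ := hd a
      obtain ⟨c', hc'⟩ := hd s
      have hs0 : algebraMap C L s ≠ 0 := by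
        rw [map_ne_zero_iff _ hCLinj]
        rintro rfl
        exact hs P.zero_mem
      have h1 : algebraMap A L d * δ (algebraMap C L a * (algebraMap C L s)⁻¹) =
          (algebraMap C L c - (algebraMap C L a * (algebraMap C L s)⁻¹) * algebraMap C L c') *
            (algebraMap C L s)⁻¹ := by
        rw [Derivation.leibniz, Derivation.leibniz_inv, ← hc, ← hc']
        simp only [smul_eq_mul]
        field_simp
        ring
      rw [h1]
      exact R'.mul_mem (R'.sub_mem (hCR c) (R'.mul_mem hb (hCR c'))) (hCu s hs)

/-- Let `L / K` be a finite extension of the field of fractions of a Noetherian domain `A` of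
equal characteristic zero, and let `z` be a prime element of `A`. Some valuation ring `B` of `L`
lies above the local ring of `A` at `z` and is such that every derivation of `L` that is logarithmic
on `A` along `z` is logarithmic on `B`. -/
theorem Prime.exists_valuationSubring_derivation_div_mem
    (k : Type*) {A : Type*} (K L : Type*) [CommRing k] [CommRing A] [IsDomain A]
    [IsNoetherianRing A]
    [Algebra ℚ A] [Field K] [Field L] [Algebra k L] [Algebra A K] [IsFractionRing A K]
    [Algebra K L] [Algebra A L] [IsScalarTower A K L] [FiniteDimensional K L]
    [Algebra.IsSeparable K L] {z : A} (hz : Prime z) :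
    ∃ B : ValuationSubring L, (∀ a : A, algebraMap A L a ∈ B) ∧
      (∀ c : K, algebraMap K L c ∈ B →
        ∃ a s : A, ¬ z ∣ s ∧ c * algebraMap A K s = algebraMap A K a) ∧
      ∀ δ : Derivation k L L, (∀ a : A, ∃ a' : A, δ (algebraMap A L a) = algebraMap A L a') →
        (∃ a' : A, δ (algebraMap A L z) = algebraMap A L (z * a')) →
        ∀ b ∈ B, b ≠ 0 → δ b / b ∈ B := by
  let p : Ideal A := Ideal.span {z}
  have hp : p.IsPrime := (Ideal.span_singleton_prime hz.ne_zero).mpr hz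
  -- The localization at `(z)` has principal nonzero maximal ideal, so it is a discrete valuation
  -- ring with uniformizer `z`.
  let A' := Localization.subalgebra.ofField K p.primeCompl p.primeCompl_le_nonZeroDivisors
  have hloc : IsLocalization.AtPrime A' p := Localization.subalgebra.isLocalization_ofField ..
  have hnoeth : IsNoetherianRing A' := IsLocalization.isNoetherianRing p.primeCompl _ ‹_›
  have hlocal : IsLocalRing A' := IsLocalization.AtPrime.isLocalRing A' p
  have hmax : IsLocalRing.maximalIdeal A' = Ideal.span {algebraMap A A' z} := by
    rw [← IsLocalization.AtPrime.map_eq_maximalIdeal p A', Ideal.map_span, Set.image_singleton]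
  have hinj : Function.Injective (algebraMap A A') := FaithfulSMul.algebraMap_injective A A'
  have hz0 : algebraMap A A' z ≠ 0 := (map_ne_zero_iff _ hinj).mpr hz.ne_zero
  have hnf : ¬ IsField A' := by
    rw [IsLocalRing.isField_iff_maximalIdeal_eq, hmax, Ideal.span_singleton_eq_bot]
    exact hz0
  have hpr : (IsLocalRing.maximalIdeal A').IsPrincipal := ⟨⟨_, hmax⟩⟩
  have hdvr : IsDiscreteValuationRing A' :=
    ((IsDiscreteValuationRing.TFAE A' hnf).out 0 4).mpr hpr
  have hirr : Irreducible (algebraMap A A' z) :=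
    (IsDiscreteValuationRing.irreducible_iff_uniformizer _).mpr hmax
  let _ : Algebra ℚ A' := Algebra.compHom A' (algebraMap ℚ A)
  have hAL : ∀ a : A, algebraMap A' L (algebraMap A A' a) = algebraMap A L a := fun a ↦
    (IsScalarTower.algebraMap_apply A K L a).symm
  have hmem : ∀ x : A', ∃ a s : A, ¬ z ∣ s ∧ (x : K) = algebraMap A K a * (algebraMap A K s)⁻¹ := by
    rintro ⟨x, a, s, hs, rfl⟩
    exact ⟨a, s, fun h ↦ hs (Ideal.mem_span_singleton.mpr h), rfl⟩
  have hs0 : ∀ s, ¬ z ∣ s → algebraMap A K s ≠ 0 := by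
    intro s hs
    rw [map_ne_zero_iff _ (IsFractionRing.injective A K)]
    rintro rfl
    exact hs (dvd_zero z)
  obtain ⟨B, hAB, hBK, hB⟩ :=
    IsDiscreteValuationRing.exists_valuationSubring_derivation_div_mem k A' K L hirr
  refine ⟨B, fun a ↦ hAL a ▸ hAB _, fun c hc ↦ ?_, fun δ hδ hδz ↦ hB δ ?_ ?_⟩
  · obtain ⟨x, rfl⟩ := hBK c hc
    obtain ⟨a, s, hs, hx⟩ := hmem x
    refine ⟨a, s, hs, ?_⟩
    change (x : K) * _ = _
    have := hs0 s hs
    rw [hx]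
    field_simp
  · intro x
    obtain ⟨a, s, hs, hx⟩ := hmem x
    obtain ⟨a', ha'⟩ := hδ a
    obtain ⟨s', hs'⟩ := hδ s
    have h1 : ∀ y : A', algebraMap A' L y = algebraMap K L y := fun y ↦ rfl
    have h2 : algebraMap A' L x = algebraMap A L a * (algebraMap A L s)⁻¹ := by
      rw [h1, hx, map_mul, map_inv₀, IsScalarTower.algebraMap_apply A K L,
        IsScalarTower.algebraMap_apply A K L]
    have h3 := hs0 s hs
    have h4 : algebraMap A L s ≠ 0 := by
      rwa [IsScalarTower.algebraMap_apply A K L, map_ne_zero]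
    have h5 : s * s ∈ p.primeCompl := fun h ↦ by
      rcases hz.dvd_or_dvd (Ideal.mem_span_singleton.mp h) with h | h <;> exact hs h
    -- The quotient rule for `a / s`; the denominator stays outside `(z)`.
    let y : A' := ⟨algebraMap A K (s * a' - a * s') * (algebraMap A K (s * s))⁻¹, _, _, h5, rfl⟩
    have h6 : algebraMap A' L y =
        algebraMap A L (s * a' - a * s') * (algebraMap A L (s * s))⁻¹ := by
      rw [h1, map_mul, map_inv₀, ← IsScalarTower.algebraMap_apply A K L,
        ← IsScalarTower.algebraMap_apply A K L]
    refine ⟨y, ?_⟩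
    rw [h2, h6, Derivation.leibniz, Derivation.leibniz_inv, ha', hs']
    simp only [smul_eq_mul, map_sub, map_mul]
    field_simp
    ring
  · obtain ⟨a', ha'⟩ := hδz
    exact ⟨algebraMap A A' a', by rw [← map_mul, hAL, hAL, ha']⟩

/-! ### Regular local rings -/

section RegularLocal

open IsLocalRing

theorem IsLocalRing.ringKrullDim_le_card {R : Type*} [CommRing R] [IsLocalRing R]
    [IsNoetherianRing R] {s : Finset R} (hs : Ideal.span (s : Set R) = maximalIdeal R) :
    ringKrullDim R ≤ s.card := by
  refine (ringKrullDim_le_spanFinrank_maximalIdeal R).trans ?_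
  rw [← hs]
  exact_mod_cast (Submodule.spanFinrank_span_le_ncard_of_finite s.finite_toSet).trans_eq
    (Set.ncard_coe_finset s)

/-- The remaining generators bound the dimension of the quotient by `n`, while killing one element
lowers the dimension by at most one. So the hypotheses of regularity pass to the quotient, which
permits induction on the dimension. -/
theorem IsLocalRing.exists_finset_span_quotient {R : Type*} [CommRing R] [IsLocalRing R]
    [IsNoetherianRing R] {s : Finset R} {n : ℕ} (hs : Ideal.span (s : Set R) = maximalIdeal R)
    (hcard : s.card ≤ n + 1) (hdim : ringKrullDim R = (n + 1 : ℕ)) {x : R} (hx : x ∈ s) :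
    ∃ _ : IsLocalRing (R ⧸ Ideal.span {x}), ∃ t : Finset (R ⧸ Ideal.span {x}),
      Ideal.span (t : Set (R ⧸ Ideal.span {x})) = maximalIdeal (R ⧸ Ideal.span {x}) ∧
        t.card ≤ n ∧ ringKrullDim (R ⧸ Ideal.span {x}) = n := by
  classical
  have hxm : x ∈ maximalIdeal R := hs ▸ Ideal.subset_span hx
  have hle : Ideal.span {x} ≤ maximalIdeal R := by simpa [Ideal.span_le] using hxm
  have hnt : Nontrivial (R ⧸ Ideal.span {x}) :=
    Ideal.Quotient.nontrivial_iff.mpr (ne_top_of_le_ne_top (maximalIdeal.isMaximal R).ne_top hle)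
  have hsurj : Function.Surjective (Ideal.Quotient.mk (Ideal.span {x})) :=
    Ideal.Quotient.mk_surjective
  have hloc : IsLocalRing (R ⧸ Ideal.span {x}) := .of_surjective' _ hsurj
  have hmax : (maximalIdeal R).map (Ideal.Quotient.mk (Ideal.span {x})) =
      maximalIdeal (R ⧸ Ideal.span {x}) := by
    refine eq_maximalIdeal (Ideal.IsMaximal.map_of_surjective_of_ker_le hsurj ?_)
    rwa [Ideal.mk_ker]
  let t := (s.erase x).image (Ideal.Quotient.mk (Ideal.span {x}))
  have ht : Ideal.span (t : Set (R ⧸ Ideal.span {x})) = maximalIdeal (R ⧸ Ideal.span {x}) := by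
    rw [← hmax, ← hs, Ideal.map_span]
    refine le_antisymm (Ideal.span_mono ?_) (Ideal.span_le.mpr ?_)
    · rw [Finset.coe_image]
      exact Set.image_mono (by simp)
    · rintro _ ⟨y, hy, rfl⟩
      by_cases hyx : y = x
      · have : Ideal.Quotient.mk (Ideal.span {x}) y = 0 := by
          rw [Ideal.Quotient.eq_zero_iff_mem, hyx]
          exact Ideal.mem_span_singleton_self x
        rw [this]
        exact Ideal.zero_mem _
      · exact Ideal.subset_span (Finset.mem_coe.mpr (Finset.mem_image_of_mem _
          (Finset.mem_erase.mpr ⟨hyx, hy⟩)))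
  have htc : t.card ≤ n := by
    refine Finset.card_image_le.trans ?_
    rw [Finset.card_erase_of_mem hx]
    omega
  refine ⟨hloc, t, ht, htc, le_antisymm ((ringKrullDim_le_card ht).trans (by exact_mod_cast htc)) ?_⟩
  have h1 := ringKrullDim_le_ringKrullDim_quotient_add_spanFinrank (Ideal.span {x})
    (by rwa [ringJacobson_eq_maximalIdeal])
  have h2 : (Ideal.span {x}).spanFinrank ≤ 1 :=
    (Submodule.spanFinrank_span_le_ncard_of_finite (Set.finite_singleton x)).trans (by simp)
  rw [hdim] at h1
  have h3 : ((n : WithBot ℕ∞) + 1) ≤ ringKrullDim (R ⧸ Ideal.span {x}) + 1 := by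
    refine le_trans (by exact_mod_cast h1) (add_le_add_right (by exact_mod_cast h2) _)
  have h4 : ringKrullDim (R ⧸ Ideal.span {x}) ≤ n :=
    (ringKrullDim_le_card ht).trans (by exact_mod_cast htc)
  obtain ⟨m, hm⟩ : ∃ m : ℕ, ringKrullDim (R ⧸ Ideal.span {x}) = m := by
    obtain ⟨m, hm⟩ := WithBot.ne_bot_iff_exists.mp (ringKrullDim_ne_bot (R := R ⧸ Ideal.span {x}))
    have : m ≤ n := by rw [← hm] at h4; exact_mod_cast h4
    lift m to ℕ using ne_top_of_le_ne_top (ENat.natCast_ne_top n) this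
    exact ⟨m, hm.symm⟩
  rw [hm] at h3 ⊢
  have : n + 1 ≤ m + 1 := by exact_mod_cast h3
  exact_mod_cast (by omega : n ≤ m)

/-- A Noetherian local ring whose maximal ideal is generated by as many elements as the dimension is
a domain. -/
theorem IsLocalRing.isDomain_of_card_le_ringKrullDim (n : ℕ) : ∀ {R : Type*} [CommRing R]
    [IsLocalRing R] [IsNoetherianRing R] {s : Finset R},
    Ideal.span (s : Set R) = maximalIdeal R → s.card ≤ n → ringKrullDim R = n → IsDomain R := by
  classical
  induction n with
  | zero =>
    intro R _ _ _ s hs hcard _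
    rw [Finset.card_eq_zero.mp (Nat.le_zero.mp hcard), Finset.coe_empty, Ideal.span_empty] at hs
    exact (isField_iff_maximalIdeal_eq.mpr hs.symm).isDomain
  | succ n ih =>
    intro R _ _ _ s hs hcard hdim
    have hm0 : maximalIdeal R ∉ minimalPrimes R := by
      intro h
      have h1 := Ideal.height_eq_zero_iff.mpr h
      have h2 := maximalIdeal_height_eq_ringKrullDim (R := R)
      rw [h1, hdim] at h2
      exact absurd (by exact_mod_cast h2 : 0 = n + 1) (by omega)
    have hfin := minimalPrimes.finite_of_isNoetherianRing R
    -- Prime avoidance: otherwise the maximal ideal is contained in its square, hence zero by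
    -- Nakayama, or in a minimal prime. Both contradict positive dimension.
    obtain ⟨x, hxm, hx2, hxp⟩ : ∃ x ∈ maximalIdeal R, x ∉ maximalIdeal R ^ 2 ∧
        ∀ p ∈ minimalPrimes R, x ∉ p := by
      by_contra! hcon
      have hsub : (maximalIdeal R : Set R) ⊆
          ⋃ I ∈ ((insert (maximalIdeal R ^ 2) hfin.toFinset : Finset (Ideal R)) : Set (Ideal R)),
            (I : Set R) := by
        intro y hy
        by_cases hy2 : y ∈ maximalIdeal R ^ 2
        · exact Set.mem_biUnion (by simp) hy2
        · obtain ⟨p, hp, hyp⟩ := hcon y hy hy2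
          exact Set.mem_biUnion (by simp [hp]) hyp
      -- Prime avoidance tolerates two ideals that are not prime; the square of the maximal ideal
      -- fills both places.
      replace hsub := (Ideal.subset_union_prime (f := fun I : Ideal R ↦ I) (maximalIdeal R ^ 2)
        (maximalIdeal R ^ 2) ?_).mp hsub
      · obtain ⟨I, hI, hle⟩ := hsub
        rcases Finset.mem_insert.mp hI with rfl | hI
        · have hbot : maximalIdeal R = ⊥ := by
            refine Submodule.eq_bot_of_le_smul_of_le_jacobson_bot (maximalIdeal R) _
              (IsNoetherian.noetherian _) ?_ (jacobson_eq_maximalIdeal ⊥ bot_ne_top).ge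
            rwa [smul_eq_mul, ← pow_two]
          have := (isField_iff_maximalIdeal_eq.mpr hbot).isDomain
          apply hm0
          rw [hbot, IsDomain.minimalPrimes_eq_singleton_bot]
          rfl
        · have hI' : I ∈ minimalPrimes R := hfin.mem_toFinset.mp hI
          have : I = maximalIdeal R := le_antisymm (le_maximalIdeal hI'.1.1.ne_top) hle
          exact hm0 (this ▸ hI')
      · intro I hI h1 _
        rcases Finset.mem_insert.mp hI with rfl | hI
        · exact absurd rfl h1
        · exact (hfin.mem_toFinset.mp hI).1.1
    -- As `x` is not in the square of the maximal ideal, one of its coefficients is a unit, so `x`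
    -- can replace the corresponding generator `y`.
    obtain ⟨y, hys, hxy⟩ : ∃ y ∈ s, y ∈ Ideal.span {x} ⊔ Ideal.span (↑(s.erase y) : Set R) := by
      have hxs : x ∈ Ideal.span (s : Set R) := hs ▸ hxm
      obtain ⟨c, hc⟩ := Submodule.mem_span_finset'.mp hxs
      by_cases hcm : ∀ a, c a ∈ maximalIdeal R
      · refine absurd ?_ hx2
        rw [← hc, pow_two]
        exact Ideal.sum_mem _ fun a _ ↦ Ideal.mul_mem_mul (hcm a) (hs ▸ Ideal.subset_span a.2)
      · push Not at hcm
        obtain ⟨a, ha⟩ := hcm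
        refine ⟨a, a.2, ?_⟩
        obtain ⟨u, hu⟩ := notMem_maximalIdeal.mp ha
        have h1 : (a : R) = ↑u⁻¹ * (x - ∑ b ∈ Finset.univ.erase a, c b * b) := by
          rw [← hc, ← Finset.add_sum_erase _ _ (Finset.mem_univ a)]
          simp only [smul_eq_mul, add_sub_cancel_right, ← hu, Units.inv_mul_cancel_left]
        refine Set.mem_of_eq_of_mem h1 (Ideal.mul_mem_left _ _ (sub_mem (Ideal.mem_sup_left (Ideal.mem_span_singleton_self x))
          (Ideal.mem_sup_right (Ideal.sum_mem _ fun b hb ↦ Ideal.mul_mem_left _ _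
            (Ideal.subset_span ?_)))))
        exact Finset.mem_coe.mpr (Finset.mem_erase.mpr
          ⟨fun h ↦ (Finset.mem_erase.mp hb).1 (Subtype.ext h), b.2⟩)
    let s' := insert x (s.erase y)
    have hs' : Ideal.span (s' : Set R) = maximalIdeal R := by
      rw [Finset.coe_insert, Ideal.span_insert]
      refine le_antisymm (sup_le (by simpa [Ideal.span_le] using hxm) ?_) ?_
      · rw [← hs]
        exact Ideal.span_mono (by simp)
      · rw [← hs, Ideal.span_le]
        intro w hw
        by_cases hwy : w = y
        · rwa [hwy]
        · exact Ideal.mem_sup_right (Ideal.subset_span (by simp [hwy, Finset.mem_coe.mp hw]))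
    have hcard' : s'.card ≤ n + 1 := by
      refine (Finset.card_insert_le _ _).trans ?_
      rw [Finset.card_erase_of_mem hys]
      omega
    obtain ⟨_, t, ht, htc, htd⟩ :=
      exists_finset_span_quotient hs' hcard' hdim (Finset.mem_insert_self x _)
    have hdom := ih ht htc htd
    have hprime : (Ideal.span {x}).IsPrime := (Ideal.Quotient.isDomain_iff_prime _).mp hdom
    -- A minimal prime `p` inside the prime `(x)` does not contain `x`, so `p = x p` and Nakayama
    -- gives `p = 0`.
    obtain ⟨p, hp, hpx⟩ := Ideal.exists_minimalPrimes_le (I := ⊥) (J := Ideal.span {x}) bot_le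
    have hpp : p.IsPrime := hp.1.1
    have hpbot : p = ⊥ := by
      refine Submodule.eq_bot_of_le_smul_of_le_jacobson_bot (maximalIdeal R) p
        (IsNoetherian.noetherian _) ?_ (jacobson_eq_maximalIdeal ⊥ bot_ne_top).ge
      intro w hw
      obtain ⟨v, rfl⟩ := Ideal.mem_span_singleton'.mp (hpx hw)
      rw [mul_comm]
      refine Submodule.smul_mem_smul hxm ((hpp.mem_or_mem hw).resolve_right (hxp p hp))
    exact IsDomain.of_bot_isPrime (A := R) (hbp := hpbot ▸ hpp)

/-- The members of a regular system of parameters of a regular local ring are prime elements. -/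
theorem IsLocalRing.prime_of_span_eq_maximalIdeal {R : Type*} [CommRing R]
    [IsLocalRing R] [IsNoetherianRing R] {d : ℕ} (z : Fin d → R)
    (hz : Ideal.span (Set.range z) = maximalIdeal R) (hdim : ringKrullDim R = d) (i : Fin d) :
    Prime (z i) := by
  classical
  obtain ⟨n, rfl⟩ : ∃ n, d = n + 1 := ⟨d - 1, by have := i.pos; omega⟩
  have hs : Ideal.span ((Finset.univ.image z : Finset R) : Set R) = maximalIdeal R := by
    rw [Finset.coe_image, Finset.coe_univ, Set.image_univ, hz]
  obtain ⟨_, t, ht, htc, htd⟩ := exists_finset_span_quotient hs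
    (Finset.card_image_le.trans (by simp)) hdim (x := z i) (by simp)
  have hdom := isDomain_of_card_le_ringKrullDim n ht htc htd
  have hprime : (Ideal.span {z i}).IsPrime := (Ideal.Quotient.isDomain_iff_prime _).mp hdom
  refine (Ideal.span_singleton_prime ?_).mp hprime
  intro h0
  rw [h0, Ideal.span_singleton_eq_bot.mpr rfl,
    ringKrullDim_eq_of_ringEquiv (RingEquiv.quotientBot R), hdim] at htd
  exact absurd (by exact_mod_cast htd : n + 1 = n) (by omega)

end RegularLocal

/-- An element `c` of the field of fractions of a domain `A` lies in `A` if it has no pole away from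
finitely many principal prime divisors, nor along these. -/
theorem IsFractionRing.exists_algebraMap_eq_of_prime {A K ι : Type*} [CommRing A] [IsDomain A]
    [Field K] [Algebra A K] [IsFractionRing A K] (c : K) (s : Finset ι) (z : ι → A)
    (hz : ∀ i ∈ s, Prime (z i))
    (hgen : ∀ p : Ideal A, p.IsPrime → (∀ i ∈ s, z i ∉ p) →
      ∃ a b : A, b ∉ p ∧ c * algebraMap A K b = algebraMap A K a)
    (hdiv : ∀ i ∈ s, ∃ a b : A, ¬ z i ∣ b ∧ c * algebraMap A K b = algebraMap A K a) :
    ∃ a, algebraMap A K a = c := by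
  classical
  -- The ideal of denominators of `c`; the aim is `1 ∈ I`.
  let I : Ideal A :=
    { carrier := {b | ∃ a, c * algebraMap A K b = algebraMap A K a}
      add_mem' := by
        rintro b b' ⟨a, h⟩ ⟨a', h'⟩
        exact ⟨a + a', by rw [map_add, mul_add, h, h', map_add]⟩
      zero_mem' := ⟨0, by simp⟩
      smul_mem' := by
        rintro r b ⟨a, h⟩
        exact ⟨r * a, by rw [smul_eq_mul, map_mul, mul_left_comm, h, map_mul]⟩ }
  have hinj := IsFractionRing.injective A K
  -- By `hgen`, a prime containing `I` must contain some `z i`.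
  have hrad : ∏ i ∈ s, z i ∈ I.radical := by
    rw [Ideal.radical_eq_sInf, Submodule.mem_sInf]
    rintro p ⟨hIp, hp⟩
    by_contra hcon
    obtain ⟨a, b, hb, hab⟩ := hgen p hp fun i hi hzi ↦ hcon (Ideal.prod_mem _ hi hzi)
    exact hb (hIp ⟨a, hab⟩)
  obtain ⟨n, hn⟩ := hrad
  -- The factors `z i` are cancelled one at a time: as `c` has a denominator prime to `z i`, the
  -- numerator of `c` over a product involving `z i` is divisible by `z i`.
  have hcancel : ∀ m : Multiset ι, (∀ i ∈ m, i ∈ s) → (m.map z).prod ∈ I → (1 : A) ∈ I := by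
    intro m
    induction m using Multiset.induction_on with
    | empty => intro _ h; simpa using h
    | cons i m ih =>
      intro hm h
      refine ih (fun j hj ↦ hm j (Multiset.mem_cons_of_mem hj)) ?_
      rw [Multiset.map_cons, Multiset.prod_cons] at h
      obtain ⟨a, ha⟩ := h
      have hi := hm i (Multiset.mem_cons_self i m)
      obtain ⟨a', b, hb, hab⟩ := hdiv i hi
      have hdvd : z i ∣ b * a := by
        refine ⟨(m.map z).prod * a', hinj ?_⟩
        rw [map_mul, ← ha, map_mul, map_mul, map_mul, ← hab]
        ring
      obtain ⟨q, rfl⟩ := ((hz i hi).dvd_or_dvd hdvd).resolve_left hb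
      refine ⟨q, ?_⟩
      have h0 : algebraMap A K (z i) ≠ 0 := (map_ne_zero_iff _ hinj).mpr (hz i hi).ne_zero
      apply mul_left_cancel₀ h0
      rw [map_mul, map_mul] at ha
      linear_combination ha
  obtain ⟨a, ha⟩ := hcancel (n • s.val) (fun i hi ↦ Multiset.mem_of_mem_nsmul hi)
    (by rw [Multiset.map_nsmul, Multiset.prod_nsmul]; exact hn)
  exact ⟨a, by rw [← ha, map_one, mul_one]⟩

/-! ### Differentials at a smooth point, and their logarithmic bases -/

open IsLocalRing TensorProduct KaehlerDifferential in
/-- At a regular point, over a perfect field, the differentials of a regular system of parameters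
are linearly independent modulo the maximal ideal. -/
theorem IsLocalRing.linearIndependent_tmul_D (k : Type*) {A : Type*} [Field k] [PerfectField k]
    [CommRing A] [IsLocalRing A] [IsNoetherianRing A] [Algebra k A] [Algebra.EssFiniteType k A]
    [Algebra.FormallySmooth k A] {d : ℕ} (z : Fin d → A)
    (hz : Ideal.span (Set.range z) = maximalIdeal A) (hdim : ringKrullDim A = d) :
    LinearIndependent (ResidueField A)
      fun i ↦ (1 : ResidueField A) ⊗ₜ[A] KaehlerDifferential.D k A (z i) := by
  classical
  have hess : Algebra.EssFiniteType k (ResidueField A) :=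
    inferInstanceAs (Algebra.EssFiniteType k (A ⧸ maximalIdeal A))
  have hfs : Algebra.FormallySmooth k (ResidueField A) := inferInstance
  -- The residue field is formally smooth over the perfect field `k`, so the conormal map into the
  -- differentials is split injective.
  obtain ⟨l, hl⟩ := (Algebra.FormallySmooth.iff_split_injection (R := k) (P := A)
    (A := ResidueField A) residue_surjective).mp hfs
  have hker : RingHom.ker (algebraMap A (ResidueField A)) = maximalIdeal A := ker_residue
  have hinj : Function.Injective (kerCotangentToTensor k A (ResidueField A)) :=
    Function.LeftInverse.injective (g := l) fun x ↦ LinearMap.congr_fun hl x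
  rw [Fintype.linearIndependent_iff]
  intro c hc i
  choose b hb using fun j ↦ residue_surjective (c j)
  have hx : ∑ j, b j * z j ∈ RingHom.ker (algebraMap A (ResidueField A)) := by
    rw [hker, ← hz]
    exact Ideal.sum_mem _ fun j _ ↦ Ideal.mul_mem_left _ _ (Ideal.subset_span ⟨j, rfl⟩)
  have hzm : ∀ j, residue A (z j) = 0 := fun j ↦ by
    rw [residue_eq_zero_iff, ← hz]
    exact Ideal.subset_span ⟨j, rfl⟩
  have hsq : ∑ j, b j * z j ∈ maximalIdeal A ^ 2 := by
    have h1 : kerCotangentToTensor k A (ResidueField A) (Ideal.toCotangent _ ⟨_, hx⟩) = 0 := by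
      rw [kerCotangentToTensor_toCotangent, map_sum, TensorProduct.tmul_sum, ← hc]
      refine Finset.sum_congr rfl fun j _ ↦ ?_
      rw [Derivation.leibniz, TensorProduct.tmul_add, ← TensorProduct.smul_tmul,
        ← TensorProduct.smul_tmul, Algebra.smul_def, Algebra.smul_def,
        ResidueField.algebraMap_eq, hzm, hb, zero_mul, TensorProduct.zero_tmul, add_zero,
        TensorProduct.smul_tmul', smul_eq_mul]
    rw [← map_zero (kerCotangentToTensor k A (ResidueField A))] at h1
    have h2 := hinj h1
    rw [Ideal.toCotangent_eq_zero] at h2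
    rwa [← hker]
  by_contra hci
  have hu : IsUnit (b i) := by
    rw [← notMem_maximalIdeal, ← residue_eq_zero_iff, hb]
    exact hci
  obtain ⟨u, hu⟩ := hu
  let s := (Finset.univ.erase i).image z
  -- A unit coefficient expresses `z i` through the other parameters modulo the square of the
  -- maximal ideal. By Nakayama, fewer than `d` elements then generate, against the dimension.
  have hle : maximalIdeal A ≤ Ideal.span (s : Set A) := by
    refine Submodule.le_of_le_smul_of_le_jacobson_bot (I := maximalIdeal A)
      (IsNoetherian.noetherian _) (jacobson_eq_maximalIdeal ⊥ bot_ne_top).ge ?_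
    rw [smul_eq_mul, ← pow_two]
    nth_rw 1 [← hz]
    rw [Ideal.span_le]
    have hs : ∀ j, j ≠ i → z j ∈ Ideal.span (s : Set A) := fun j hj ↦
      Ideal.subset_span (Finset.mem_coe.mpr (Finset.mem_image_of_mem _ (by simp [hj])))
    rintro _ ⟨j, rfl⟩
    by_cases hj : j = i
    · subst hj
      have h1 : z j = ↑u⁻¹ * (-(∑ m ∈ Finset.univ.erase j, b m * z m) + ∑ m, b m * z m) := by
        rw [← Finset.add_sum_erase _ _ (Finset.mem_univ j), ← hu]
        rw [neg_add_cancel_comm_assoc, Units.inv_mul_cancel_left]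
      refine Set.mem_of_eq_of_mem h1 (Ideal.mul_mem_left _ _ (add_mem
        (Ideal.mem_sup_left (neg_mem (Ideal.sum_mem _ fun m hm ↦ Ideal.mul_mem_left _ _
          (hs m (Finset.mem_erase.mp hm).1)))) (Ideal.mem_sup_right hsq)))
    · exact Ideal.mem_sup_left (hs j hj)
  have heq : Ideal.span (s : Set A) = maximalIdeal A := by
    refine le_antisymm ?_ hle
    rw [← hz]
    refine Ideal.span_mono ?_
    rw [Finset.coe_image]
    exact Set.image_subset_range _ _
  have hlt : s.card < d := by
    refine Finset.card_image_le.trans_lt ?_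
    rw [Finset.card_erase_of_mem (Finset.mem_univ i), Finset.card_univ, Fintype.card_fin]
    have := i.pos
    omega
  have := ringKrullDim_le_card heq
  rw [hdim] at this
  exact absurd (by exact_mod_cast this : d ≤ s.card) (by omega)

open IsLocalRing TensorProduct in
/-- At a regular point, over a perfect field, the differentials of a regular system of parameters
are part of a basis of the module of differentials. -/
theorem IsLocalRing.exists_basis_kaehlerDifferential (k : Type) {A : Type} [Field k]
    [PerfectField k]
    [CommRing A] [IsLocalRing A] [IsNoetherianRing A] [Algebra k A] [Algebra.EssFiniteType k A]
    [Algebra.FormallySmooth k A] {d : ℕ} (z : Fin d → A)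
    (hz : Ideal.span (Set.range z) = maximalIdeal A) (hdim : ringKrullDim A = d) :
    ∃ (ι : Type) (_ : Finite ι) (b : Module.Basis ι A (Ω[A⁄k])) (f : Fin d → ι),
      Function.Injective f ∧ ∀ i, b (f i) = KaehlerDifferential.D k A (z i) := by
  have hli := linearIndependent_tmul_D k z hz hdim
  let B := Module.Basis.extend hli.linearIndepOn_id
  let f : Fin d → hli.linearIndepOn_id.extend (Set.subset_univ _) := fun i ↦
    ⟨_, hli.linearIndepOn_id.subset_extend _ ⟨i, rfl⟩⟩
  have hf : Function.Injective f := fun i j hij ↦ hli.injective (congrArg Subtype.val hij)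
  -- Each basis vector over the residue field is lifted, the differentials of the parameters being
  -- the prescribed lifts of their own classes. Flatness makes the lifts independent and Nakayama
  -- makes them span.
  have hex : ∀ j, ∃ v : Ω[A⁄k], (1 : ResidueField A) ⊗ₜ[A] v = B j ∧
      ∀ i, f i = j → v = KaehlerDifferential.D k A (z i) := by
    intro j
    rw [Module.Basis.extend_apply_self]
    by_cases h : ∃ i, f i = j
    · obtain ⟨i, rfl⟩ := h
      exact ⟨_, rfl, fun i' hi' ↦ by rw [hf hi']⟩
    · obtain ⟨v, hv⟩ := TensorProduct.mk_surjective A (Ω[A⁄k]) (ResidueField A)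
        residue_surjective (j : ResidueField A ⊗[A] Ω[A⁄k])
      exact ⟨v, hv, fun i hi ↦ absurd ⟨i, hi⟩ h⟩
  choose w hB hw using hex
  have hfin : Finite (hli.linearIndepOn_id.extend (Set.subset_univ _)) :=
    Module.Finite.finite_basis B
  have hB' : TensorProduct.mk A (ResidueField A) (Ω[A⁄k]) 1 ∘ w = B := funext hB
  have hindep : LinearIndependent A w :=
    Module.IsLocalRing.linearIndependent_of_flat w (hB' ▸ B.linearIndependent)
  have hspan := span_eq_top_of_tmul_eq_basis w B hB
  exact ⟨_, hfin, .mk hindep hspan.ge, f, hf, fun i ↦ by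
    rw [Module.Basis.mk_apply, hw _ i rfl]⟩

/-- A regular system of parameters `z` of the local ring `A` of a smooth point gives a basis of the
module of logarithmic differentials of `A` along `∏ i ∈ s, z i`. -/
theorem IsLocalRing.exists_basis_log (k : Type) {A : Type} (K : Type) [Field k] [PerfectField k]
    [CommRing A] [IsDomain A] [IsLocalRing A] [IsNoetherianRing A] [Algebra k A]
    [Algebra.EssFiniteType k A]
    [Algebra.FormallySmooth k A] [Field K] [Algebra A K] [IsFractionRing A K] [Algebra k K]
    [IsScalarTower k A K] {d : ℕ} (z : Fin d → A)
    (hz : Ideal.span (Set.range z) = maximalIdeal A) (hdim : ringKrullDim A = d)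
    (s : Finset (Fin d)) :
    ∃ (ι : Type) (_ : Finite ι) (e : Module.Basis ι K (Ω[K⁄k])),
      (∀ a j, ∃ a' : A,
        e.repr (KaehlerDifferential.D k K (algebraMap A K a)) j = algebraMap A K a') ∧
      (∀ i ∈ s, ∀ j, ∃ a' : A,
        e.repr (KaehlerDifferential.D k K (algebraMap A K (z i))) j = algebraMap A K (z i * a')) ∧
      ∀ j, e j ∈ Submodule.span A
          (Set.range fun a : A ↦ KaehlerDifferential.D k K (algebraMap A K a)) ∨
        ∃ i ∈ s, e j =
          (algebraMap A K (z i))⁻¹ • KaehlerDifferential.D k K (algebraMap A K (z i)) := by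
  classical
  obtain ⟨ι, hfin, b, f, hf, hb⟩ := exists_basis_kaehlerDifferential k z hz hdim
  have hloc : IsLocalization (nonZeroDivisors A) K := inferInstance
  have hEt : Algebra.FormallyEtale A K := .of_isLocalization (nonZeroDivisors A)
  have hinj := IsFractionRing.injective A K
  let b' : Module.Basis ι K (Ω[K⁄k]) := (b.baseChange K).map
    (KaehlerDifferential.tensorKaehlerEquivOfFormallyEtale k A K)
  have hb' : ∀ j, b' j = KaehlerDifferential.map k k A K (b j) := fun j ↦ by
    simp [b']
  have hrepr : ∀ (ω : Ω[A⁄k]) (j), b'.repr (KaehlerDifferential.map k k A K ω) j =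
      algebraMap A K (b.repr ω j) := fun ω j ↦ by
    have h1 : (KaehlerDifferential.tensorKaehlerEquivOfFormallyEtale k A K).symm
        (KaehlerDifferential.map k k A K ω) = 1 ⊗ₜ[A] ω := by
      rw [LinearEquiv.symm_apply_eq,
        KaehlerDifferential.tensorKaehlerEquivOfFormallyEtale_apply,
        KaehlerDifferential.mapBaseChange_tmul, one_smul]
    simp [b', h1, Algebra.algebraMap_eq_smul_one]
  -- The equation by which the `j`-th basis form is divided: `z i` if it is the differential of a
  -- boundary parameter `z i`, and `1` otherwise.
  let w : ι → A := fun j ↦ if h : ∃ i ∈ s, f i = j then z h.choose else 1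
  have hwi : ∀ i ∈ s, w (f i) = z i := fun i hi ↦ by
    have h : ∃ i' ∈ s, f i' = f i := ⟨i, hi, rfl⟩
    simp only [w, dif_pos h]
    rw [hf h.choose_spec.2]
  have hw0 : ∀ j, algebraMap A K (w j) ≠ 0 := fun j ↦ by
    rw [map_ne_zero_iff _ hinj]
    by_cases h : ∃ i ∈ s, f i = j
    · obtain ⟨i, hi, rfl⟩ := h
      rw [hwi i hi]
      exact (prime_of_span_eq_maximalIdeal z hz hdim i).ne_zero
    · simp only [w, dif_neg h]
      exact one_ne_zero
  let u : ι → Kˣ := fun j ↦ (Units.mk0 _ (hw0 j))⁻¹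
  let e := b'.unitsSMul u
  have he : ∀ j, e j = (algebraMap A K (w j))⁻¹ • b' j := fun j ↦ by
    simp [e, u, Module.Basis.unitsSMul_apply, Units.smul_def]
  have herepr : ∀ ω j, e.repr ω j = algebraMap A K (w j) * b'.repr ω j := fun ω j ↦ by
    simp [e, u, Module.Basis.repr_unitsSMul, Units.smul_def]
  have hD : ∀ a, KaehlerDifferential.D k K (algebraMap A K a) =
      KaehlerDifferential.map k k A K (KaehlerDifferential.D k A a) := fun a ↦ by
    rw [KaehlerDifferential.map_D]
  refine ⟨ι, hfin, e, fun a j ↦ ?_, fun i hi j ↦ ?_, fun j ↦ ?_⟩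
  · rw [herepr, hD, hrepr, ← map_mul]
    exact ⟨_, rfl⟩
  · rw [herepr, hD, hrepr, ← map_mul, ← hb, b.repr_self]
    by_cases hj : j = f i
    · subst hj
      exact ⟨1, by rw [Finsupp.single_eq_same, hwi i hi]⟩
    · exact ⟨0, by rw [Finsupp.single_eq_of_ne hj, mul_zero, mul_zero]⟩
  · by_cases h : ∃ i ∈ s, f i = j
    · obtain ⟨i, hi, rfl⟩ := h
      exact .inr ⟨i, hi, by rw [he, hwi i hi, hb', hb, ← hD]⟩
    · left
      have h1 : w j = 1 := by simp only [w, dif_neg h]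
      rw [he, h1, map_one, inv_one, one_smul, hb']
      have h2 : b j ∈ Submodule.span A (Set.range (KaehlerDifferential.D k A)) := by
        rw [KaehlerDifferential.span_range_derivation]
        trivial
      have h3 := Submodule.mem_map_of_mem (f := KaehlerDifferential.map k k A K) h2
      rw [Submodule.map_span, ← Set.range_comp] at h3
      convert h3 using 3
      exact funext hD

/-! ### Symmetric differentials under a Galois extension, and the norm -/

section SymmetricDifferentials

variable {k K L : Type} [CommRing k] [Field K] [Field L] [Algebra k K] [Algebra k L] [Algebra K L]
  [IsScalarTower k K L] [Algebra.FormallyEtale K L]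

/-- The basis of the Kähler differentials of a formally étale extension `L / K` that is induced by a
basis of those of `K`. -/
noncomputable def Module.Basis.kaehlerOfFormallyEtale {ι : Type} (e : Module.Basis ι K (Ω[K⁄k])) :
    Module.Basis ι L (Ω[L⁄k]) :=
  (e.baseChange L).map (KaehlerDifferential.tensorKaehlerEquivOfFormallyEtale k K L)

theorem Module.Basis.kaehlerOfFormallyEtale_apply {ι : Type} (e : Module.Basis ι K (Ω[K⁄k]))
    (j : ι) :
    (e.kaehlerOfFormallyEtale : Module.Basis ι L (Ω[L⁄k])) j =
      KaehlerDifferential.map k k K L (e j) := by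
  simp [kaehlerOfFormallyEtale]

theorem Module.Basis.kaehlerOfFormallyEtale_repr_map {ι : Type} (e : Module.Basis ι K (Ω[K⁄k]))
    (ω : Ω[K⁄k]) (j : ι) :
    (e.kaehlerOfFormallyEtale : Module.Basis ι L (Ω[L⁄k])).repr
      (KaehlerDifferential.map k k K L ω) j = algebraMap K L (e.repr ω j) := by
  have h1 : (KaehlerDifferential.tensorKaehlerEquivOfFormallyEtale k K L).symm
      (KaehlerDifferential.map k k K L ω) = 1 ⊗ₜ[K] ω := by
    rw [LinearEquiv.symm_apply_eq, KaehlerDifferential.tensorKaehlerEquivOfFormallyEtale_apply,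
      KaehlerDifferential.mapBaseChange_tmul, one_smul]
  simp [kaehlerOfFormallyEtale, h1, Algebra.algebraMap_eq_smul_one]

/-- The coordinates of differentials in the basis `e.kaehlerOfFormallyEtale`, as derivations. -/
noncomputable def Module.Basis.kaehlerDerivation {ι : Type} (e : Module.Basis ι K (Ω[K⁄k]))
    (j : ι) : Derivation k L L :=
  ((e.kaehlerOfFormallyEtale (L := L)).coord j).compDer (KaehlerDifferential.D k L)

theorem Module.Basis.kaehlerDerivation_apply {ι : Type} (e : Module.Basis ι K (Ω[K⁄k]))
    (j : ι) (x : L) :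
    e.kaehlerDerivation j x =
      (e.kaehlerOfFormallyEtale (L := L)).repr (KaehlerDifferential.D k L x) j := rfl

theorem Module.Basis.kaehlerDerivation_algebraMap {ι : Type} (e : Module.Basis ι K (Ω[K⁄k]))
    (j : ι) (x : K) :
    e.kaehlerDerivation j (algebraMap K L x) =
      algebraMap K L (e.repr (KaehlerDifferential.D k K x) j) := by
  rw [kaehlerDerivation_apply, ← kaehlerOfFormallyEtale_repr_map, KaehlerDifferential.map_D]

/-- The difference between the `γ`-conjugate of the derivation and the derivation itself is
`K`-linear, because the derivation maps `K` into `K` and `γ` fixes `K`. It vanishes since `L / K` is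
unramified. -/
theorem Module.Basis.kaehlerDerivation_algEquiv {ι : Type} (e : Module.Basis ι K (Ω[K⁄k]))
    (j : ι) (γ : L ≃ₐ[K] L) (x : L) :
    e.kaehlerDerivation (k := k) j (γ x) = γ (e.kaehlerDerivation (k := k) j x) := by
  let δ : Derivation k L L := e.kaehlerDerivation j
  let φ : L →ₗ[K] L :=
    { toFun := fun y ↦ γ.symm (δ (γ y)) - δ y
      map_add' := fun a b ↦ by simp only [map_add]; ring
      map_smul' := fun c y ↦ by
        simp only [Algebra.smul_def, map_mul, AlgEquiv.commutes, Derivation.leibniz, map_add,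
          AlgEquiv.symm_apply_apply, RingHom.id_apply, δ, kaehlerDerivation_algebraMap,
          Algebra.algebraMap_self]
        ring }
  let D' : Derivation K L L := Derivation.mk' φ fun a b ↦ by
    simp only [φ, LinearMap.coe_mk, AddHom.coe_mk, map_mul, map_add, Derivation.leibniz,
      smul_eq_mul, AlgEquiv.symm_apply_apply]
    ring
  have h0 : D' = 0 := by
    apply (KaehlerDifferential.linearMapEquivDerivation K L (M := L)).symm.injective
    exact Subsingleton.elim _ _
  have h1 : γ.symm (δ (γ x)) - δ x = 0 := congrArg (fun D : Derivation K L L ↦ D x) h0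
  rw [sub_eq_zero, AlgEquiv.symm_apply_eq] at h1
  exact h1

theorem SymmetricAlgebra.equivMvPolynomial_kaehlerOfFormallyEtale_ι {ι : Type}
    (e : Module.Basis ι K (Ω[K⁄k])) (ω : Ω[K⁄k]) :
    equivMvPolynomial (e.kaehlerOfFormallyEtale (L := L))
      (SymmetricAlgebra.ι L (Ω[L⁄k]) (KaehlerDifferential.map k k K L ω)) =
    MvPolynomial.map (algebraMap K L)
      (equivMvPolynomial e (SymmetricAlgebra.ι K (Ω[K⁄k]) ω)) := by
  induction e.mem_span ω using Submodule.span_induction with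
  | mem ω hω =>
    obtain ⟨j, rfl⟩ := hω
    rw [← e.kaehlerOfFormallyEtale_apply, equivMvPolynomial_ι_apply, equivMvPolynomial_ι_apply,
      MvPolynomial.map_X]
  | zero => simp only [map_zero]
  | add ω ω' _ _ h h' => simp only [map_add, h, h']
  | smul c ω _ h =>
    rw [map_smul, ← algebraMap_smul L c, map_smul, map_smul, h, map_smul, map_smul,
      MvPolynomial.smul_eq_C_mul, MvPolynomial.smul_eq_C_mul, map_mul, MvPolynomial.map_C]

/-- The form `τ` is the norm of `σ`: a product of conjugates has coefficients fixed by every `γ g`,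
hence in `K`, and it is nonzero because polynomial rings over a field are domains. One `τ` serves
all bases, so that a basis adapted to each point of `Y` can be chosen later. -/
theorem SymmetricAlgebra.exists_map_equivMvPolynomial_eq_prod {G : Type} [Fintype G]
    (γ : G → L ≃ₐ[K] L)
    (hperm : ∀ h, ∃ π : G ≃ G, ∀ g x, γ h (γ g x) = γ (π g) x)
    (hfix : ∀ x : L, (∀ g, γ g x = x) → ∃ c, algebraMap K L c = x)
    (σ : SymmetricAlgebra L (Ω[L⁄k])) (hσ : σ ≠ 0) :
    ∃ τ : SymmetricAlgebra K (Ω[K⁄k]), τ ≠ 0 ∧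
      ∀ {ι : Type} (e : Module.Basis ι K (Ω[K⁄k])),
        MvPolynomial.map (algebraMap K L) (equivMvPolynomial e τ) =
          ∏ g, MvPolynomial.map (γ g : L →+* L)
            (equivMvPolynomial (e.kaehlerOfFormallyEtale (L := L)) σ) := by
  classical
  let e₀ := Module.Basis.ofVectorSpace K (Ω[K⁄k])
  let P := equivMvPolynomial (e₀.kaehlerOfFormallyEtale (L := L)) σ
  let N := ∏ g, MvPolynomial.map (γ g : L →+* L) P
  have hN : ∀ h, MvPolynomial.map (γ h : L →+* L) N = N := by
    intro h
    obtain ⟨π, hπ⟩ := hperm h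
    rw [map_prod]
    refine Fintype.prod_equiv π _ _ fun g ↦ ?_
    rw [MvPolynomial.map_map]
    have : (γ h : L →+* L).comp (γ g : L →+* L) = (γ (π g) : L →+* L) := RingHom.ext (hπ g)
    rw [this]
  obtain ⟨Q, hQ⟩ : ∃ Q, MvPolynomial.map (algebraMap K L) Q = N := by
    refine MvPolynomial.mem_range_map_iff_coeffs_subset.mpr fun x hx ↦ ?_
    obtain ⟨m, -, rfl⟩ := MvPolynomial.mem_coeffs_iff.mp hx
    refine hfix _ fun g ↦ ?_
    conv_rhs => rw [← hN g]
    rw [MvPolynomial.coeff_map]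
    rfl
  refine ⟨(equivMvPolynomial e₀).symm Q, ?_, ?_⟩
  · rw [Ne, map_eq_zero_iff _ (equivMvPolynomial e₀).symm.injective]
    rintro rfl
    rw [map_zero, eq_comm, Finset.prod_eq_zero_iff] at hQ
    obtain ⟨g, _, hg⟩ := hQ
    rw [map_eq_zero_iff _ (MvPolynomial.map_injective _ (γ g).injective)] at hg
    exact hσ ((map_eq_zero_iff _ (AlgEquiv.injective _)).mp hg)
  · intro ι e
    let ΦK := (equivMvPolynomial e₀).symm.trans (equivMvPolynomial e)
    let ΦL := (equivMvPolynomial (e₀.kaehlerOfFormallyEtale (L := L))).symm.trans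
      (equivMvPolynomial (e.kaehlerOfFormallyEtale (L := L)))
    -- The change of basis has coefficients in `K`, so it commutes with extension of scalars and
    -- with every `γ g`.
    have hX : ∀ j, ΦL (MvPolynomial.X j) =
        MvPolynomial.map (algebraMap K L) (ΦK (MvPolynomial.X j)) := by
      intro j
      simp only [ΦL, ΦK, AlgEquiv.trans_apply, equivMvPolynomial_symm_X,
        Module.Basis.kaehlerOfFormallyEtale_apply,
        equivMvPolynomial_kaehlerOfFormallyEtale_ι]
    have h1 : ∀ q, MvPolynomial.map (algebraMap K L) (ΦK q) =
        ΦL (MvPolynomial.map (algebraMap K L) q) := by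
      intro q
      induction q using MvPolynomial.induction_on with
      | C a =>
        rw [MvPolynomial.map_C]
        exact (congrArg _ (ΦK.commutes a)).trans
          ((MvPolynomial.map_C _ _).trans (ΦL.commutes _).symm)
      | add p q hp hq => simp only [map_add, hp, hq]
      | mul_X p j hp => simp only [map_mul, hp, MvPolynomial.map_X, hX]
    have h2 : ∀ g q, MvPolynomial.map (γ g : L →+* L) (ΦL q) =
        ΦL (MvPolynomial.map (γ g : L →+* L) q) := by
      intro g q
      induction q using MvPolynomial.induction_on with
      | C a =>
        rw [MvPolynomial.map_C]
        exact (congrArg _ (ΦL.commutes a)).trans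
          ((MvPolynomial.map_C _ _).trans (ΦL.commutes _).symm)
      | add p q hp hq => simp only [map_add, hp, hq]
      | mul_X p j hp =>
        simp only [map_mul, hp, MvPolynomial.map_X, hX, MvPolynomial.map_map]
        congr 3
        ext x
        simp
    have h3 : equivMvPolynomial e ((equivMvPolynomial e₀).symm Q) = ΦK Q := rfl
    have h4 : equivMvPolynomial (e.kaehlerOfFormallyEtale (L := L)) σ = ΦL P := by
      simp [ΦL, P]
    rw [h3, h4, h1, hQ, map_prod]
    exact Finset.prod_congr rfl fun g _ ↦ (h2 g P).symm

end SymmetricDifferentials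

/-! ### Symmetric forms as polynomials in a basis -/

section Coefficients

variable {K M ι : Type*} [Field K] [AddCommGroup M] [Module K M]

theorem SymmetricAlgebra.equivMvPolynomial_ι (e : Module.Basis ι K M) (ω : M) :
    equivMvPolynomial e (SymmetricAlgebra.ι K M ω) =
      (e.repr ω).sum fun j c ↦ c • MvPolynomial.X j := by
  conv_lhs => rw [← e.linearCombination_repr ω, Finsupp.linearCombination_apply, Finsupp.sum]
  simp only [map_sum, map_smul, equivMvPolynomial_ι_apply]
  rfl

theorem SymmetricAlgebra.equivMvPolynomial_ι_isHomogeneous (e : Module.Basis ι K M) (ω : M) :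
    (equivMvPolynomial e (SymmetricAlgebra.ι K M ω)).IsHomogeneous 1 := by
  rw [equivMvPolynomial_ι]
  exact MvPolynomial.IsHomogeneous.sum _ _ _ fun j _ ↦ by
    beta_reduce
    rw [MvPolynomial.smul_eq_C_mul]
    exact (MvPolynomial.isHomogeneous_X K j).C_mul _

theorem SymmetricAlgebra.equivMvPolynomial_ι_coeff_mem (e : Module.Basis ι K M) (C : Subring K)
    {ω : M} (hω : ∀ j, e.repr ω j ∈ C) (m : ι →₀ ℕ) :
    (equivMvPolynomial e (SymmetricAlgebra.ι K M ω)).coeff m ∈ C := by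
  classical
  rw [equivMvPolynomial_ι, Finsupp.sum, MvPolynomial.coeff_sum]
  refine sum_mem fun j _ ↦ ?_
  rw [MvPolynomial.coeff_smul, MvPolynomial.coeff_X, smul_eq_mul]
  split_ifs
  · rw [mul_one]; exact hω j
  · rw [mul_zero]; exact C.zero_mem

theorem MvPolynomial.coeff_prod_mem {κ : Type*} (C : Subring K) (s : Finset κ)
    (p : κ → MvPolynomial ι K) (hp : ∀ i ∈ s, ∀ m, (p i).coeff m ∈ C) (m : ι →₀ ℕ) :
    (∏ i ∈ s, p i).coeff m ∈ C := by
  classical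
  induction s using Finset.induction_on generalizing m with
  | empty =>
    rw [Finset.prod_empty, coeff_one]
    split_ifs
    · exact C.one_mem
    · exact C.zero_mem
  | insert i s hi ih =>
    rw [Finset.prod_insert hi, coeff_mul]
    exact sum_mem fun x _ ↦ C.mul_mem (hp i (Finset.mem_insert_self i s) _)
      (ih (fun j hj ↦ hp j (Finset.mem_insert_of_mem hj)) _)

theorem SymmetricAlgebra.isHomogeneous_of_mem_span (e : Module.Basis ι K M) {A : Subring K}
    {W : Set M} {n : ℕ} {σ : SymmetricAlgebra K M}
    (hσ : σ ∈ Submodule.span A {σ | ∃ ω : Fin n → M, (∀ i, ω i ∈ W) ∧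
      σ = ∏ i, SymmetricAlgebra.ι K M (ω i)}) :
    (equivMvPolynomial e σ).IsHomogeneous n := by
  induction hσ using Submodule.span_induction with
  | mem σ hσ =>
    obtain ⟨ω, hω, rfl⟩ := hσ
    rw [map_prod]
    simpa using MvPolynomial.IsHomogeneous.prod Finset.univ _ (fun _ ↦ 1)
      fun i _ ↦ equivMvPolynomial_ι_isHomogeneous e (ω i)
  | zero => rw [map_zero]; exact MvPolynomial.isHomogeneous_zero _ _ _
  | add σ σ' _ _ h h' => rw [map_add]; exact h.add h'
  | smul a σ _ h =>
    have : a • σ = (a : K) • σ := rfl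
    rw [this, map_smul, MvPolynomial.smul_eq_C_mul]
    exact h.C_mul _

/-- Integrality of coordinates survives products and sums. The ring `C` may exceed `A`: it will be a
valuation ring containing the local ring `A`. -/
theorem SymmetricAlgebra.coeff_mem_of_mem_span (e : Module.Basis ι K M) {A C : Subring K}
    (hAC : A ≤ C) {W : Set M} (hW : ∀ ω ∈ W, ∀ j, e.repr ω j ∈ C) {n : ℕ}
    {σ : SymmetricAlgebra K M}
    (hσ : σ ∈ Submodule.span A {σ | ∃ ω : Fin n → M, (∀ i, ω i ∈ W) ∧
      σ = ∏ i, SymmetricAlgebra.ι K M (ω i)}) (m : ι →₀ ℕ) :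
    (equivMvPolynomial e σ).coeff m ∈ C := by
  induction hσ using Submodule.span_induction with
  | mem σ hσ =>
    obtain ⟨ω, hω, rfl⟩ := hσ
    rw [map_prod]
    exact MvPolynomial.coeff_prod_mem C _ _
      (fun i _ ↦ equivMvPolynomial_ι_coeff_mem e C (hW _ (hω i))) m
  | zero => rw [map_zero]; exact C.zero_mem
  | add σ σ' _ _ h h' => rw [map_add]; exact C.add_mem h h'
  | smul a σ _ h =>
    have : a • σ = (a : K) • σ := rfl
    rw [this, map_smul, MvPolynomial.coeff_smul]
    exact C.mul_mem (hAC a.2) h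

/-- A monomial of degree `n` is a product of `n` basis vectors, obtained by listing its multiset of
variables. -/
theorem SymmetricAlgebra.mem_span_of_coeff_mem (e : Module.Basis ι K M) {A : Subring K}
    {W : Set M} (hW : ∀ j, e j ∈ W) {n : ℕ} {σ : SymmetricAlgebra K M}
    (hhom : (equivMvPolynomial e σ).IsHomogeneous n)
    (hcoeff : ∀ m, (equivMvPolynomial e σ).coeff m ∈ A) :
    σ ∈ Submodule.span A {σ | ∃ ω : Fin n → M, (∀ i, ω i ∈ W) ∧
      σ = ∏ i, SymmetricAlgebra.ι K M (ω i)} := by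
  classical
  have h1 : σ = (equivMvPolynomial e).symm (equivMvPolynomial e σ) := by simp
  rw [h1, (equivMvPolynomial e σ).as_sum, map_sum]
  refine Submodule.sum_mem _ fun m hm ↦ ?_
  have hdeg : (Finsupp.toMultiset m).toList.length = n := by
    rw [Multiset.length_toList, Finsupp.card_toMultiset]
    have := hhom (MvPolynomial.mem_support_iff.mp hm)
    rw [Finsupp.weight_apply] at this
    simp only [Pi.one_apply, smul_eq_mul, mul_one] at this
    exact this
  have h2 : (equivMvPolynomial e).symm (MvPolynomial.monomial m ((equivMvPolynomial e σ).coeff m)) =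
      (⟨_, hcoeff m⟩ : A) • ∏ i : Fin n, SymmetricAlgebra.ι K M
        (e ((Finsupp.toMultiset m).toList.get (i.cast hdeg.symm))) := by
    have h3 : MvPolynomial.monomial m ((equivMvPolynomial e σ).coeff m) =
        (equivMvPolynomial e σ).coeff m • (m.prod fun j n ↦ MvPolynomial.X j ^ n) := by
      rw [MvPolynomial.monomial_eq, MvPolynomial.smul_eq_C_mul]
    have h4 : (m.prod fun j n ↦ (MvPolynomial.X j : MvPolynomial ι K) ^ n) =
        ((Finsupp.toMultiset m).map MvPolynomial.X).prod := by
      rw [Finsupp.toMultiset_map, Finsupp.prod_toMultiset,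
        Finsupp.prod_mapDomain_index (fun _ ↦ pow_zero _) fun _ _ _ ↦ pow_add _ _ _]
    have h5 : (equivMvPolynomial e).symm (m.prod fun j n ↦ (MvPolynomial.X j) ^ n) =
        ∏ i : Fin n, SymmetricAlgebra.ι K M
          (e ((Finsupp.toMultiset m).toList.get (i.cast hdeg.symm))) := by
      subst hdeg
      rw [h4, map_multiset_prod, Multiset.map_map]
      simp only [Function.comp_def, equivMvPolynomial_symm_X]
      conv_lhs => rw [← Multiset.coe_toList (Finsupp.toMultiset m), Multiset.map_coe,
        Multiset.prod_coe]
      exact (Fin.prod_univ_fun_getElem _ fun j ↦ SymmetricAlgebra.ι K M (e j)).symm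
    rw [h3, map_smul, h5]
    rfl
  rw [h2]
  exact Submodule.smul_mem _ _ (Submodule.subset_span ⟨_, fun i ↦ hW _, rfl⟩)

end Coefficients

/-! ### Maps of function fields -/

section FunctionFieldMap

variable {U X Y : Scheme.{0}} [IsIntegral U] [IsIntegral X] [IsIntegral Y]

namespace AlgebraicGeometry

theorem Scheme.Hom.map_genericPoint (f : U ⟶ X) [IsDominant f] :
    f (genericPoint U) = genericPoint X := by
  apply ((genericPoint_spec X).eq _).symm
  convert (genericPoint_spec U).image f.continuous
  rw [Set.image_univ]
  exact f.denseRange.closure_range.symm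

instance Scheme.Hom.isDominant_of_isOpenImmersion (i : U ⟶ X) [IsOpenImmersion i] :
    IsDominant i :=
  ⟨i.isOpenEmbedding.isOpen_range.dense (Set.range_nonempty _)⟩

/-- The map of function fields induced by a dominant morphism of integral schemes. -/
noncomputable def Scheme.Hom.functionFieldMap (f : U ⟶ X) [IsDominant f] :
    X.functionField →+* U.functionField :=
  (X.presheaf.stalkSpecializes (specializes_of_eq f.map_genericPoint) ≫
    f.stalkMap (genericPoint U)).hom

theorem Scheme.genericPoint_mem (W : X.Opens) {x : X} (hx : x ∈ W) : genericPoint X ∈ W :=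
  ((genericPoint_spec X).specializes trivial).mem_open W.isOpen hx

theorem Scheme.Hom.functionFieldMap_germ (f : U ⟶ X) [IsDominant f] (W : X.Opens)
    (hW : genericPoint X ∈ W) (s : Γ(X, W)) :
    f.functionFieldMap (X.presheaf.germ W _ hW s) =
      U.presheaf.germ (f ⁻¹ᵁ W) (genericPoint U) (by
        change f (genericPoint U) ∈ W; rwa [f.map_genericPoint]) (f.app W s) := by
  have h := f.germ_stalkMap W (genericPoint U) (by rwa [f.map_genericPoint])
  rw [← X.presheaf.germ_stalkSpecializes hW (specializes_of_eq f.map_genericPoint),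
    Category.assoc] at h
  exact congr($(h).hom s)

theorem algebraMap_stalk_germ (W : X.Opens) {x : X} (hx : x ∈ W) (s : Γ(X, W)) :
    algebraMap (X.presheaf.stalk x) X.functionField (X.presheaf.germ W x hx s) =
      X.presheaf.germ W (genericPoint X) (X.genericPoint_mem W hx) s :=
  have : Nonempty W := ⟨⟨x, hx⟩⟩
  X.algebraMap_germ_eq_germToFunctionField hx s

theorem Scheme.Hom.functionFieldMap_algebraMap (f : U ⟶ X) [IsDominant f] (u : U)
    (a : X.presheaf.stalk (f u)) :
    f.functionFieldMap (algebraMap _ X.functionField a) =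
      algebraMap (U.presheaf.stalk u) U.functionField (f.stalkMap u a) := by
  obtain ⟨W, hW, s, rfl⟩ := X.presheaf.exists_germ_eq a
  have h1 : f.stalkMap u (X.presheaf.germ W (f u) hW s) =
    U.presheaf.germ (f ⁻¹ᵁ W) u hW (f.app W s) := f.germ_stalkMap_apply W u hW s
  rw [h1]
  exact (congrArg _ (algebraMap_stalk_germ W hW s)).trans ((f.functionFieldMap_germ W _ s).trans
    (algebraMap_stalk_germ (f ⁻¹ᵁ W) hW _).symm)

theorem Scheme.Hom.functionFieldMap_comp (f : U ⟶ X) (g : X ⟶ Y) [IsDominant f] [IsDominant g]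
    (x : Y.functionField) :
    (f ≫ g).functionFieldMap x = f.functionFieldMap (g.functionFieldMap x) := by
  obtain ⟨W, hW, s, rfl⟩ := Y.presheaf.exists_germ_eq x
  have h1 := g.functionFieldMap_germ W hW s
  have h2 := (f ≫ g).functionFieldMap_germ W hW s
  rw [h1, h2, functionFieldMap_germ]
  exact congrArg (U.presheaf.germ (f ⁻¹ᵁ g ⁻¹ᵁ W) (genericPoint U) _)
    congr($(Scheme.Hom.comp_app f g W) s)

theorem Scheme.Hom.functionFieldMap_algebraMap_complex [U.Over LogSym.SpecC]
    [X.Over LogSym.SpecC] (f : U ⟶ X) [IsDominant f] (hf : f.IsOver LogSym.SpecC) (c : ℂ) :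
    f.functionFieldMap (algebraMap ℂ X.functionField c) = algebraMap ℂ U.functionField c := by
  change f.functionFieldMap (X.presheaf.germ ⊤ (genericPoint X) trivial
    ((X ↘ LogSym.SpecC).appTop ((Scheme.ΓSpecIso (CommRingCat.of ℂ)).inv c))) =
    U.presheaf.germ ⊤ (genericPoint U) trivial
      ((U ↘ LogSym.SpecC).appTop ((Scheme.ΓSpecIso (CommRingCat.of ℂ)).inv c))
  refine (f.functionFieldMap_germ ⊤ trivial _).trans
    (congrArg (U.presheaf.germ ⊤ (genericPoint U) trivial) ?_)
  have h1 : (U ↘ LogSym.SpecC) = f ≫ (X ↘ LogSym.SpecC) := (comp_over f _).symm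
  rw [h1]
  exact (congr($(Scheme.Hom.comp_appTop f (X ↘ LogSym.SpecC)) _)).symm

theorem Scheme.Hom.functionFieldMap_bijective (i : U ⟶ X) [IsOpenImmersion i] :
    Function.Bijective i.functionFieldMap := by
  have : IsIso (X.presheaf.stalkSpecializes (specializes_of_eq i.map_genericPoint)) :=
    (X.presheaf.stalkCongr (.of_eq i.map_genericPoint.symm)).isIso_hom
  have : IsIso (X.presheaf.stalkSpecializes (specializes_of_eq i.map_genericPoint) ≫
    i.stalkMap (genericPoint U)) := inferInstance
  exact ConcreteCategory.bijective_of_isIso (X.presheaf.stalkSpecializes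
    (specializes_of_eq i.map_genericPoint) ≫ i.stalkMap (genericPoint U))

theorem Scheme.Hom.functionFieldMap_mem_localRing_iff (i : U ⟶ X) [IsOpenImmersion i] (u : U)
    (x : X.functionField) :
    i.functionFieldMap x ∈ LogSym.localRing u ↔ x ∈ LogSym.localRing (i u) := by
  constructor
  · rintro ⟨a, ha⟩
    obtain ⟨b, rfl⟩ := (ConcreteCategory.bijective_of_isIso (i.stalkMap u)).2 a
    refine ⟨b, i.functionFieldMap.injective ?_⟩
    rw [functionFieldMap_algebraMap]
    exact ha
  · rintro ⟨b, rfl⟩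
    exact ⟨_, (i.functionFieldMap_algebraMap u b).symm⟩

theorem Scheme.Hom.functionFieldMap_mem_localRing (f : U ⟶ X) [IsDominant f] (u : U)
    {x : X.functionField} (hx : x ∈ LogSym.localRing (f u)) :
    f.functionFieldMap x ∈ LogSym.localRing u := by
  obtain ⟨b, rfl⟩ := hx
  exact ⟨_, (f.functionFieldMap_algebraMap u b).symm⟩

end AlgebraicGeometry

end FunctionFieldMap

/-! ### Projectivity and centers of valuations -/

section Center

attribute [local instance] MvPolynomial.gradedAlgebra

/-- `Proj` is universally closed over the spectrum of the degree zero part, and that part is a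
quotient of `ℂ`, which gives a closed immersion. -/
theorem LogSym.ProjSpace.universallyClosed_structureMap (n : ℕ) :
    UniversallyClosed (ProjSpace.structureMap n) := by
  have h0 : Function.Surjective
      (algebraMap ℂ (MvPolynomial.homogeneousSubmodule (Fin (n + 1)) ℂ 0)) := by
    rintro ⟨p, hp⟩
    rw [MvPolynomial.homogeneousSubmodule_zero, Submodule.mem_one] at hp
    obtain ⟨c, rfl⟩ := hp
    exact ⟨c, rfl⟩
  have : Algebra.FiniteType (MvPolynomial.homogeneousSubmodule (Fin (n + 1)) ℂ 0)
      (MvPolynomial (Fin (n + 1)) ℂ) :=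
    (RingHom.FiniteType.of_comp_finiteType (f := algebraMap ℂ
        (MvPolynomial.homogeneousSubmodule (Fin (n + 1)) ℂ 0))
      (g := algebraMap _ (MvPolynomial (Fin (n + 1)) ℂ))
      (RingHom.finiteType_algebraMap.mpr
        (inferInstanceAs (Algebra.FiniteType ℂ (MvPolynomial (Fin (n + 1)) ℂ)))) :)
  have : IsClosedImmersion (Spec.map (CommRingCat.ofHom
      (algebraMap ℂ (MvPolynomial.homogeneousSubmodule (Fin (n + 1)) ℂ 0)))) :=
    IsClosedImmersion.spec_of_surjective _ h0
  exact MorphismProperty.comp_mem @UniversallyClosed _ _ (inferInstanceAs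
    (UniversallyClosed (Proj.toSpecZero (MvPolynomial.homogeneousSubmodule (Fin (n + 1)) ℂ))))
    inferInstance

theorem LogSym.IsProjective.universallyClosed {X : Scheme.{0}} [X.Over SpecC]
    (hX : IsProjective X) : UniversallyClosed (X ↘ SpecC) := by
  obtain ⟨n, i, hi, h⟩ := hX
  have := ProjSpace.universallyClosed_structureMap n
  rw [← h]
  infer_instance

/-- By the valuative criterion, the generic point of `X` extends to a morphism from `Spec B`. The
image of the closed point is the center. -/
theorem LogSym.exists_localRing_le {X : Scheme.{0}} [X.Over SpecC] [IsIntegral X]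
    [UniversallyClosed (X ↘ SpecC)] (B : ValuationSubring X.functionField)
    (hB : ∀ c : ℂ, algebraMap ℂ X.functionField c ∈ B) :
    ∃ x : X, localRing x ≤ B.toSubring := by
  let ψ : ℂ →+* B := (algebraMap ℂ X.functionField).codRestrict B.toSubring hB
  have hV : ValuativeCriterion.Existence (X ↘ SpecC) := by
    have : UniversallyClosed (X ↘ SpecC) := inferInstance
    rw [UniversallyClosed.eq_valuativeCriterion] at this
    exact this.1
  let S : ValuativeCommSq (X ↘ SpecC) :=
    { R := B
      K := X.functionField
      i₁ := X.fromSpecStalk (genericPoint X)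
      i₂ := Spec.map (CommRingCat.ofHom ψ)
      commSq := ⟨by
        have h1 : (X ↘ SpecC).appTop ≫ X.presheaf.germ ⊤ (genericPoint X) trivial =
            (Scheme.ΓSpecIso (CommRingCat.of ℂ)).hom ≫ CommRingCat.ofHom ψ ≫
              CommRingCat.ofHom (algebraMap B X.functionField) := by
          rw [← Iso.inv_comp_eq]
          rfl
        rw [← cancel_mono SpecC.toSpecΓ, Category.assoc, Scheme.toSpecΓ_naturality,
          Scheme.fromSpecStalk_toSpecΓ_assoc, ← Spec.map_comp, h1, ← AlgebraicGeometry.SpecMap_ΓSpecIso_hom,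
          ← Spec.map_comp, ← Spec.map_comp]⟩ }
  obtain ⟨⟨l, hl, -⟩⟩ := hV S
  let x := l (IsLocalRing.closedPoint B)
  refine ⟨x, ?_⟩
  have h1 : Spec.map (Scheme.stalkClosedPointTo (R := CommRingCat.of B) l) ≫ X.fromSpecStalk x = l :=
    Scheme.Spec_stalkClosedPointTo_fromSpecStalk (R := CommRingCat.of B) l
  have h2 : Spec.map (Scheme.stalkClosedPointTo (R := CommRingCat.of B) l ≫
      CommRingCat.ofHom (algebraMap B X.functionField)) =
      Spec.map (X.presheaf.stalkSpecializes ((genericPoint_spec X).specializes trivial)) := by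
    rw [← cancel_mono (X.fromSpecStalk x), Spec.map_comp, Category.assoc, h1,
      Scheme.SpecMap_stalkSpecializes_fromSpecStalk]
    exact hl
  have h3 := Spec.map_injective h2
  rintro _ ⟨a, rfl⟩
  have h4 : (Scheme.stalkClosedPointTo (R := CommRingCat.of B) l a : X.functionField) =
    algebraMap (X.presheaf.stalk x) X.functionField a := congr($(h3).hom a)
  rw [← h4]
  exact (Scheme.stalkClosedPointTo (R := CommRingCat.of B) l a).2

end Center

/-! ### Local rings of smooth schemes over `ℂ` -/

section Stalk

namespace LogSym

variable (X : Scheme.{0}) [X.Over SpecC]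

/-- The local rings of a `ℂ`-scheme are `ℂ`-algebras, through the structure morphism. -/
noncomputable instance stalkAlgebra (x : X) : Algebra ℂ (X.presheaf.stalk x) :=
  ((X.presheaf.germ ⊤ x trivial).hom.comp
    ((X ↘ SpecC).appTop.hom.comp (Scheme.ΓSpecIso (CommRingCat.of ℂ)).inv.hom)).toAlgebra

instance isScalarTower_stalk_functionField [IsIntegral X] (x : X) :
    IsScalarTower ℂ (X.presheaf.stalk x) X.functionField :=
  .of_algebraMap_eq fun _ ↦ (algebraMap_stalk_germ (X := X) ⊤ trivial _).symm

theorem exists_smooth_isLocalization_stalk [Smooth (X ↘ SpecC)] (x : X) :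
    ∃ (R : Type) (_ : CommRing R) (_ : Algebra ℂ R) (_ : Algebra R (X.presheaf.stalk x))
      (_ : IsScalarTower ℂ R (X.presheaf.stalk x)) (p : Ideal R) (_ : p.IsPrime),
      Algebra.Smooth ℂ R ∧ IsLocalization.AtPrime (X.presheaf.stalk x) p := by
  obtain ⟨_, ⟨W, hW, rfl⟩, hxW, -⟩ :=
    X.isBasis_affineOpens.exists_subset_of_mem_open (Set.mem_univ x) isOpen_univ
  have h1 := Smooth.smooth_appLE (X ↘ SpecC) (isAffineOpen_top _) hW le_top
  have h2 : (((X ↘ SpecC).appLE ⊤ W le_top).hom.comp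
      (Scheme.ΓSpecIso (CommRingCat.of ℂ)).inv.hom).Smooth :=
    RingHom.Smooth.respectsIso.2 _
      (Scheme.ΓSpecIso (CommRingCat.of ℂ)).symm.commRingCatIsoToRingEquiv h1
  let _ : Algebra ℂ Γ(X, W) := (((X ↘ SpecC).appLE ⊤ W le_top).hom.comp
      (Scheme.ΓSpecIso (CommRingCat.of ℂ)).inv.hom).toAlgebra
  let _ := X.presheaf.algebra_section_stalk ⟨x, hxW⟩
  have h3 : IsScalarTower ℂ Γ(X, W) (X.presheaf.stalk x) := by
    refine .of_algebraMap_eq fun c ↦ ?_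
    change _ = X.presheaf.germ W x hxW
      (X.presheaf.map (homOfLE le_top).op ((X ↘ SpecC).app ⊤ _))
    exact (X.presheaf.germ_res_apply _ x hxW _).symm
  exact ⟨Γ(X, W), inferInstance, inferInstance, inferInstance, h3, _, inferInstance,
    h2, hW.isLocalization_stalk ⟨x, hxW⟩⟩

instance formallySmooth_stalk [Smooth (X ↘ SpecC)] (x : X) :
    Algebra.FormallySmooth ℂ (X.presheaf.stalk x) := by
  obtain ⟨R, _, _, _, _, p, _, _, _⟩ := exists_smooth_isLocalization_stalk X x
  have := Algebra.FormallySmooth.of_isLocalization (Rₘ := X.presheaf.stalk x) p.primeCompl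
  exact Algebra.FormallySmooth.comp ℂ R _

instance essFiniteType_stalk [Smooth (X ↘ SpecC)] (x : X) :
    Algebra.EssFiniteType ℂ (X.presheaf.stalk x) := by
  obtain ⟨R, _, _, _, _, p, _, _, _⟩ := exists_smooth_isLocalization_stalk X x
  have := Algebra.EssFiniteType.of_isLocalization (X.presheaf.stalk x) p.primeCompl
  exact Algebra.EssFiniteType.comp ℂ R _

instance isNoetherianRing_stalk [Smooth (X ↘ SpecC)] (x : X) :
    IsNoetherianRing (X.presheaf.stalk x) :=
  Algebra.EssFiniteType.isNoetherianRing ℂ _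

end LogSym

end Stalk

/-! ### Generizations of a point and primes of its local ring -/

section Specialization

namespace LogSym

variable {X : Scheme.{0}}

theorem algebraMap_stalkSpecializes [IsIntegral X] {x y : X} (h : y ⤳ x) (a : X.presheaf.stalk x) :
    algebraMap (X.presheaf.stalk y) X.functionField (X.presheaf.stalkSpecializes h a) =
      algebraMap (X.presheaf.stalk x) X.functionField a := by
  obtain ⟨W, hW, s, rfl⟩ := X.presheaf.exists_germ_eq a
  have h1 : X.presheaf.stalkSpecializes h (X.presheaf.germ W x hW s) =
    X.presheaf.germ W y (h.mem_open W.isOpen hW) s :=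
    congr($(X.presheaf.germ_stalkSpecializes hW h) s)
  rw [h1]
  exact (algebraMap_stalk_germ W _ s).trans (algebraMap_stalk_germ W hW s).symm

theorem localRing_le_of_specializes [IsIntegral X] {x y : X} (h : y ⤳ x) : localRing x ≤ localRing y := by
  rintro _ ⟨a, rfl⟩
  exact ⟨_, algebraMap_stalkSpecializes h a⟩

theorem fromSpecStalk_specializes (x : X) (p : Spec (X.presheaf.stalk x)) :
    X.fromSpecStalk x p ⤳ x := by
  have : X.fromSpecStalk x p ∈ Set.range (X.fromSpecStalk x) := ⟨p, rfl⟩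
  rwa [Scheme.range_fromSpecStalk] at this

/-- Since `Spec` of the local ring embeds in `X`, the prime `p` is the preimage of the maximal ideal
of the local ring at its image. -/
theorem isUnit_stalkSpecializes_iff (x : X) (p : Spec (X.presheaf.stalk x))
    (a : X.presheaf.stalk x) :
    IsUnit (X.presheaf.stalkSpecializes (fromSpecStalk_specializes x p) a) ↔ a ∉ p.asIdeal := by
  let y := X.fromSpecStalk x p
  let m : Spec (X.presheaf.stalk y) := IsLocalRing.closedPoint (X.presheaf.stalk y)
  have hsp : y ⤳ x := fromSpecStalk_specializes x p
  have h1 : X.fromSpecStalk x (Spec.map (X.presheaf.stalkSpecializes hsp) m) =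
      X.fromSpecStalk x p := by
    rw [← Scheme.Hom.comp_apply, Scheme.SpecMap_stalkSpecializes_fromSpecStalk]
    exact Scheme.fromSpecStalk_closedPoint
  have h2 := (X.fromSpecStalk x).isEmbedding.injective h1
  have h3 : a ∈ (Spec.map (X.presheaf.stalkSpecializes hsp) m).asIdeal ↔
    X.presheaf.stalkSpecializes hsp a ∈ IsLocalRing.maximalIdeal (X.presheaf.stalk y) := .rfl
  have h4 : (Spec.map (X.presheaf.stalkSpecializes hsp) m).asIdeal = p.asIdeal :=
    congrArg PrimeSpectrum.asIdeal h2
  rw [← h4, h3, IsLocalRing.mem_maximalIdeal, mem_nonunits_iff, not_not]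

theorem inv_algebraMap_mem_localRing_fromSpecStalk [IsIntegral X] (x : X) (p : Spec (X.presheaf.stalk x))
    {a : X.presheaf.stalk x} (ha : a ∉ p.asIdeal) :
    (algebraMap _ X.functionField a)⁻¹ ∈ localRing (X.fromSpecStalk x p) := by
  obtain ⟨u, hu⟩ := (isUnit_stalkSpecializes_iff x p a).mpr ha
  refine ⟨↑u⁻¹, eq_inv_of_mul_eq_one_left ?_⟩
  rw [← algebraMap_stalkSpecializes (fromSpecStalk_specializes x p), ← hu, ← map_mul,
    Units.inv_mul, map_one]

theorem exists_eq_div_of_mem_localRing_fromSpecStalk [IsIntegral X] (x : X) (p : Spec (X.presheaf.stalk x))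
    {c : X.functionField} (hc : c ∈ localRing (X.fromSpecStalk x p)) :
    ∃ a s : X.presheaf.stalk x, s ∉ p.asIdeal ∧
      c * algebraMap _ X.functionField s = algebraMap _ X.functionField a := by
  obtain ⟨c, rfl⟩ := hc
  obtain ⟨_, ⟨W, hW, rfl⟩, hxW, -⟩ :=
    X.isBasis_affineOpens.exists_subset_of_mem_open (Set.mem_univ x) isOpen_univ
  have hsp := fromSpecStalk_specializes x p
  have hyW := hsp.mem_open W.isOpen hxW
  let y : W := ⟨X.fromSpecStalk x p, hyW⟩
  let _ := X.presheaf.algebra_section_stalk y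
  have := hW.isLocalization_stalk y
  have hgerm (s : Γ(X, W)) : X.presheaf.stalkSpecializes hsp (X.presheaf.germ W x hxW s) =
      X.presheaf.germ W y hyW s := congr($(X.presheaf.germ_stalkSpecializes hxW hsp) s)
  obtain ⟨⟨a, s⟩, h⟩ := IsLocalization.surj (hW.primeIdealOf y).asIdeal.primeCompl c
  refine ⟨X.presheaf.germ W x hxW a, X.presheaf.germ W x hxW s, ?_, ?_⟩
  · rw [← isUnit_stalkSpecializes_iff, hgerm]
    exact IsLocalization.map_units _ s
  · rw [← algebraMap_stalkSpecializes hsp, ← algebraMap_stalkSpecializes hsp, hgerm, hgerm,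
      ← map_mul]
    exact congrArg _ h

end LogSym

end Specialization

/-! ### Unramified, flat and finite extensions -/

/-- Modulo the image of `C`, the derivation becomes an `A`-linear derivation of `C`, and such
derivations vanish. -/
theorem Derivation.mem_range_of_formallyUnramified {k A C L : Type*} [CommRing k] [CommRing A]
    [CommRing C] [CommRing L] [Algebra k L] [Algebra A C] [Algebra C L] [Algebra A L]
    [IsScalarTower A C L] [Algebra.FormallyUnramified A C] (δ : Derivation k L L)
    (hδ : ∀ a : A, ∃ c : C, algebraMap C L c = δ (algebraMap A L a)) (c : C) :
    ∃ c' : C, algebraMap C L c' = δ (algebraMap C L c) := by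
  let N : Submodule C L := LinearMap.range (Algebra.linearMap C L)
  have hN (c : C) (x : L) (hx : ∃ c', algebraMap C L c' = x) :
      N.mkQ (algebraMap C L c * x) = 0 := by
    obtain ⟨c', rfl⟩ := hx
    rw [Submodule.mkQ_apply, Submodule.Quotient.mk_eq_zero]
    exact ⟨c * c', map_mul (algebraMap C L) c c'⟩
  have hsmul (c : C) (x : L) : N.mkQ (algebraMap C L c * x) = c • N.mkQ x := by
    rw [← Algebra.smul_def]
    exact N.mkQ.map_smul c x
  let D₀ : C →ₗ[A] L ⧸ N :=
    { toFun := fun c ↦ N.mkQ (δ (algebraMap C L c))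
      map_add' := fun x y ↦ by simp only [map_add]
      map_smul' := fun a x ↦ by
        rw [Algebra.smul_def, map_mul, ← IsScalarTower.algebraMap_apply A C L, δ.leibniz, map_add,
          smul_eq_mul, smul_eq_mul, hN _ _ (hδ a), add_zero, RingHom.id_apply,
          ← algebraMap_smul C a, ← hsmul, ← IsScalarTower.algebraMap_apply A C L] }
  let D : Derivation A C (L ⧸ N) := Derivation.mk' D₀ fun x y ↦ by
    simp only [D₀, LinearMap.coe_mk, AddHom.coe_mk, map_mul, δ.leibniz, map_add, smul_eq_mul,
      hsmul]
  have hD : D = 0 := by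
    apply (KaehlerDifferential.linearMapEquivDerivation A C (M := L ⧸ N)).symm.injective
    exact Subsingleton.elim _ _
  have h1 : N.mkQ (δ (algebraMap C L c)) = 0 := congrArg (fun D : Derivation A C (L ⧸ N) ↦ D c) hD
  rwa [Submodule.mkQ_apply, Submodule.Quotient.mk_eq_zero] at h1

/-- If `x = a / b`, then `a` lies in `bC ∩ A`, which is `bA` by faithful flatness. -/
theorem IsFractionRing.mem_range_of_faithfullyFlat {A C K L : Type*} [CommRing A] [IsDomain A]
    [CommRing C] [Field K] [Field L] [Algebra A K] [IsFractionRing A K] [Algebra A C] [Algebra C L]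
    [FaithfulSMul C L] [Algebra K L] [Algebra A L] [IsScalarTower A K L] [IsScalarTower A C L]
    [Module.FaithfullyFlat A C] {x : K} {c : C} (hx : algebraMap C L c = algebraMap K L x) :
    ∃ a : A, algebraMap A K a = x := by
  obtain ⟨a, b, hb, rfl⟩ := IsFractionRing.div_surjective (A := A) x
  have hb0 : algebraMap A K b ≠ 0 := by
    simpa using nonZeroDivisors.ne_zero hb
  have h1 : algebraMap A C a = c * algebraMap A C b := by
    apply FaithfulSMul.algebraMap_injective C L
    rw [map_mul, hx, ← IsScalarTower.algebraMap_apply, ← IsScalarTower.algebraMap_apply,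
      IsScalarTower.algebraMap_apply A K L, IsScalarTower.algebraMap_apply A K L b, ← map_mul,
      div_mul_cancel₀ _ hb0]
  have h2 : a ∈ (Ideal.map (algebraMap A C) (Ideal.span {b})).comap (algebraMap A C) := by
    rw [Ideal.mem_comap, h1]
    exact Ideal.mul_mem_left _ _ (Ideal.mem_map_of_mem _ (Ideal.mem_span_singleton_self b))
  rw [Ideal.comap_map_eq_self_of_faithfullyFlat, Ideal.mem_span_singleton] at h2
  obtain ⟨a', rfl⟩ := h2
  exact ⟨a', by rw [map_mul, mul_div_cancel_left₀ _ hb0]⟩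

theorem IsFractionRing.finiteDimensional_of_finite {R S K L : Type*} [CommRing R] [CommRing S]
    [Field K] [Field L] [Algebra R S] [Module.Finite R S] [Algebra S L] [IsFractionRing S L]
    [Algebra R K] [Algebra K L] [Algebra R L] [IsScalarTower R K L] [IsScalarTower R S L] :
    FiniteDimensional K L := by
  classical
  obtain ⟨s, hs⟩ := Module.Finite.fg_top (R := R) (M := S)
  let T : Set L := algebraMap S L '' s
  have hT : ∀ x ∈ T, IsIntegral K x := by
    rintro _ ⟨x, -, rfl⟩
    exact ((Algebra.IsIntegral.isIntegral (R := R) x).map (IsScalarTower.toAlgHom R S L)).tower_top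
  have : Finite T := (s.finite_toSet.image _).to_subtype
  have hfin := IntermediateField.finiteDimensional_adjoin hT
  have hS : ∀ x : S, algebraMap S L x ∈ IntermediateField.adjoin K T := by
    intro x
    have hx : x ∈ Submodule.span R (s : Set S) := hs ▸ Submodule.mem_top
    induction hx using Submodule.span_induction with
    | mem x hx => exact IntermediateField.subset_adjoin K T ⟨x, hx, rfl⟩
    | zero => rw [map_zero]; exact zero_mem _
    | add x y _ _ hx hy => rw [map_add]; exact add_mem hx hy
    | smul r x _ hx =>
      rw [Algebra.smul_def, map_mul, ← IsScalarTower.algebraMap_apply,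
        IsScalarTower.algebraMap_apply R K L]
      exact mul_mem (IntermediateField.algebraMap_mem _ _) hx
  have htop : IntermediateField.adjoin K T = ⊤ := by
    refine eq_top_iff.mpr fun x _ ↦ ?_
    obtain ⟨a, b, -, rfl⟩ := IsFractionRing.div_surjective (A := S) x
    exact div_mem (hS a) (hS b)
  rw [htop] at hfin
  exact IntermediateField.topEquiv.toLinearEquiv.finiteDimensional

/-- A fixed `x = a / b` equals `(x * N) / N`, where `N` is the norm of `b`. Both terms are fixed and
in `S`, since `N` has `b` among its factors. -/
theorem Field.mem_of_forall_fixed {G L : Type*} [Fintype G] [Field L] (S : Subring L)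
    (hS : ∀ x, ∃ a ∈ S, ∃ b ∈ S, x = a / b) (γ : G → L →+* L) (hγS : ∀ g, ∀ x ∈ S, γ g x ∈ S)
    (e : G) (he : ∀ x, γ e x = x)
    (hperm : ∀ h, ∃ π : G ≃ G, ∀ g x, γ h (γ g x) = γ (π g) x) (F : Subfield L)
    (hF : ∀ x ∈ S, (∀ g, γ g x = x) → x ∈ F) {x : L} (hx : ∀ g, γ g x = x) : x ∈ F := by
  classical
  obtain ⟨a, ha, b, hb, hxab⟩ := hS x
  by_cases hb0 : b = 0
  · rw [hxab, hb0, div_zero]; exact F.zero_mem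
  let N := ∏ g, γ g b
  have hN0 : N ≠ 0 := Finset.prod_ne_zero_iff.mpr fun g _ ↦ (map_ne_zero _).mpr hb0
  have hNS : N ∈ S := S.prod_mem fun g _ ↦ hγS g b hb
  have hNγ : ∀ h, γ h N = N := by
    intro h
    obtain ⟨π, hπ⟩ := hperm h
    rw [map_prod]
    exact Fintype.prod_equiv π _ _ fun g ↦ hπ g b
  have hxN : x * N ∈ S := by
    have : x * N = a * ∏ g ∈ Finset.univ.erase e, γ g b := by
      simp only [N]
      rw [← Finset.mul_prod_erase _ _ (Finset.mem_univ e), he, ← mul_assoc, hxab,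
        div_mul_cancel₀ _ hb0]
    rw [this]
    exact S.mul_mem ha (S.prod_mem fun g _ ↦ hγS g b hb)
  rw [← mul_div_cancel_right₀ x hN0]
  exact F.div_mem (hF _ hxN fun g ↦ by rw [map_mul, hx, hNγ]) (hF _ hNS hNγ)

/-! ### Function fields of étale and Galois covers -/

section GaloisCover

namespace AlgebraicGeometry

variable {U X Y : Scheme.{0}} [IsIntegral U] [IsIntegral X] [IsIntegral Y]

theorem Scheme.Hom.functionFieldMap_congr {f g : U ⟶ X} [IsDominant f] [IsDominant g] (h : f = g)
    (x : X.functionField) : f.functionFieldMap x = g.functionFieldMap x := by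
  subst h
  rfl

theorem Scheme.Hom.functionFieldMap_id (x : U.functionField) :
    Scheme.Hom.functionFieldMap (𝟙 U) x = x := by
  obtain ⟨W, hW, s, rfl⟩ := U.presheaf.exists_germ_eq x
  refine (functionFieldMap_germ (𝟙 U) W hW s).trans ?_
  exact congrArg (U.presheaf.germ W (genericPoint U) hW) congr($(Scheme.Hom.id_app W) s)

/-- The isomorphism of function fields induced by an open immersion of integral schemes. -/
noncomputable def Scheme.Hom.functionFieldEquiv (i : U ⟶ X) [IsOpenImmersion i] :
    X.functionField ≃+* U.functionField :=
  RingEquiv.ofBijective i.functionFieldMap i.functionFieldMap_bijective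

theorem Scheme.Hom.functionFieldEquiv_apply (i : U ⟶ X) [IsOpenImmersion i]
    (x : X.functionField) : i.functionFieldEquiv x = i.functionFieldMap x := rfl

theorem Scheme.Hom.functionFieldMap_mem_localRing_iff_of_flat (f : U ⟶ X) [IsDominant f]
    [Flat f] (u : U) (x : X.functionField) :
    f.functionFieldMap x ∈ LogSym.localRing u ↔ x ∈ LogSym.localRing (f u) := by
  refine ⟨?_, f.functionFieldMap_mem_localRing u⟩
  rintro ⟨c, hc⟩
  let _ := (f.stalkMap u).hom.toAlgebra
  let _ := f.functionFieldMap.toAlgebra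
  let _ := (f.functionFieldMap.comp
    (algebraMap (X.presheaf.stalk (f u)) X.functionField)).toAlgebra
  have : IsScalarTower (X.presheaf.stalk (f u)) X.functionField U.functionField :=
    .of_algebraMap_eq fun _ ↦ rfl
  have : IsScalarTower (X.presheaf.stalk (f u)) (U.presheaf.stalk u) U.functionField :=
    .of_algebraMap_eq fun a ↦ f.functionFieldMap_algebraMap u a
  have : Module.Flat (X.presheaf.stalk (f u)) (U.presheaf.stalk u) := Flat.stalkMap f u
  have : IsLocalHom (algebraMap (X.presheaf.stalk (f u)) (U.presheaf.stalk u)) :=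
    inferInstanceAs (IsLocalHom (f.stalkMap u).hom)
  have : Module.FaithfullyFlat (X.presheaf.stalk (f u)) (U.presheaf.stalk u) :=
    Module.FaithfullyFlat.of_flat_of_isLocalHom
  exact IsFractionRing.mem_range_of_faithfullyFlat (A := X.presheaf.stalk (f u))
    (L := U.functionField) hc

/-- The field `L` stands for the function field of a compactification, where the derivation lives,
while the local rings are those of `U`; `E` identifies the two. -/
theorem Scheme.Hom.derivation_mem_localRing (f : U ⟶ X) [IsDominant f] [FormallyUnramified f]
    (u : U) {L : Type} [Field L] [Algebra ℂ L] (E : L ≃+* U.functionField) (δ : Derivation ℂ L L)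
    (hδ : ∀ x ∈ LogSym.localRing (f u), E (δ (E.symm (f.functionFieldMap x))) ∈
      LogSym.localRing u) {x : L} (hx : E x ∈ LogSym.localRing u) :
    E (δ x) ∈ LogSym.localRing u := by
  let _ := (f.stalkMap u).hom.toAlgebra
  let _ := ((E.symm : U.functionField →+* L).comp
    (algebraMap (U.presheaf.stalk u) U.functionField)).toAlgebra
  let _ := ((algebraMap (U.presheaf.stalk u) L).comp (f.stalkMap u).hom).toAlgebra
  have : IsScalarTower (X.presheaf.stalk (f u)) (U.presheaf.stalk u) L :=
    .of_algebraMap_eq fun _ ↦ rfl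
  have : Algebra.FormallyUnramified (X.presheaf.stalk (f u)) (U.presheaf.stalk u) :=
    FormallyUnramified.stalkMap f u
  obtain ⟨c, hc⟩ := hx
  have hcx : algebraMap (U.presheaf.stalk u) L c = x := by
    rw [← E.symm_apply_apply x, ← hc]; rfl
  obtain ⟨c', hc'⟩ := δ.mem_range_of_formallyUnramified (A := X.presheaf.stalk (f u)) (fun a ↦ by
    obtain ⟨b, hb⟩ := hδ _ ⟨a, rfl⟩
    refine ⟨b, E.injective ?_⟩
    have h1 : algebraMap (X.presheaf.stalk (f u)) L a =
      E.symm (f.functionFieldMap (algebraMap _ X.functionField a)) :=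
        congrArg E.symm (f.functionFieldMap_algebraMap u a).symm
    rw [h1, ← hb]
    exact E.apply_symm_apply _) c
  rw [← hcx, ← hc']
  exact ⟨c', (E.apply_symm_apply _).symm⟩

theorem Scheme.exists_affine_nonempty (X : Scheme.{0}) [IsIntegral X] :
    ∃ W : X.Opens, IsAffineOpen W ∧ genericPoint X ∈ W := by
  obtain ⟨_, ⟨W, hW, rfl⟩, hxW, -⟩ := X.isBasis_affineOpens.exists_subset_of_mem_open
    (Set.mem_univ (genericPoint X)) isOpen_univ
  exact ⟨W, hW, hxW⟩

theorem Scheme.Hom.functionFieldMap_finite (f : U ⟶ X) [IsDominant f] [IsFinite f] :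
    f.functionFieldMap.Finite := by
  obtain ⟨W, hW, hη⟩ := X.exists_affine_nonempty
  have hη' : genericPoint U ∈ f ⁻¹ᵁ W := by
    change f (genericPoint U) ∈ W
    rwa [f.map_genericPoint]
  have : Nonempty W := ⟨⟨_, hη⟩⟩
  have : Nonempty (f ⁻¹ᵁ W) := ⟨⟨_, hη'⟩⟩
  have := functionField_isFractionRing_of_isAffineOpen U (f ⁻¹ᵁ W) (hW.preimage f)
  let _ := (f.app W).hom.toAlgebra
  let _ := f.functionFieldMap.toAlgebra
  let _ := (f.functionFieldMap.comp (algebraMap Γ(X, W) X.functionField)).toAlgebra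
  have : Module.Finite Γ(X, W) Γ(U, f ⁻¹ᵁ W) := f.finite_app W hW
  have : IsScalarTower Γ(X, W) X.functionField U.functionField := .of_algebraMap_eq fun _ ↦ rfl
  have : IsScalarTower Γ(X, W) Γ(U, f ⁻¹ᵁ W) U.functionField :=
    .of_algebraMap_eq fun s ↦ f.functionFieldMap_germ W hη s
  exact IsFractionRing.finiteDimensional_of_finite (R := Γ(X, W)) (S := Γ(U, f ⁻¹ᵁ W))

instance Scheme.isIso_aut_hom {X : Scheme.{0}} (g : Aut X) : IsIso g.hom := Iso.isIso_hom g

end AlgebraicGeometry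

open LogSym in
-- Over an affine open of `V`, invariant regular functions descend by the definition of a quotient;
-- invariant fractions reduce to these by taking norms of denominators.
theorem LogSym.IsQuotientBy.mem_range_functionFieldMap {U V : Scheme.{0}} [IsIntegral U]
    [IsIntegral V] {G : Subgroup (Aut U)} [Finite G] {f : U ⟶ V} [IsDominant f] [IsAffineHom f]
    (hf : IsQuotientBy G f) {x : U.functionField}
    (hx : ∀ g ∈ G, g.hom.functionFieldMap x = x) : x ∈ f.functionFieldMap.fieldRange := by
  have := Fintype.ofFinite G
  obtain ⟨W, hW, hη⟩ := V.exists_affine_nonempty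
  have hη' : genericPoint U ∈ f ⁻¹ᵁ W := by
    change f (genericPoint U) ∈ W
    rwa [f.map_genericPoint]
  have : Nonempty (f ⁻¹ᵁ W) := ⟨⟨_, hη'⟩⟩
  have := functionField_isFractionRing_of_isAffineOpen U (f ⁻¹ᵁ W) (hW.preimage f)
  have hle (g : Aut U) (hg : g ∈ G) : f ⁻¹ᵁ W ≤ g.hom ⁻¹ᵁ f ⁻¹ᵁ W := by
    rw [← Scheme.Hom.comp_preimage, hf.invariant g hg]
  have hg (g : Aut U) (hg : g ∈ G) (s : Γ(U, f ⁻¹ᵁ W)) :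
      g.hom.functionFieldMap (algebraMap _ U.functionField s) =
        algebraMap _ U.functionField (g.hom.appLE _ _ (hle g hg) s) := by
    refine (g.hom.functionFieldMap_germ _ hη' s).trans ?_
    exact (U.presheaf.germ_res_apply (homOfLE (hle g hg)) _ hη' _).symm
  refine Field.mem_of_forall_fixed (G := G) (algebraMap Γ(U, f ⁻¹ᵁ W) U.functionField).range
    (fun x ↦ ?_) (fun g ↦ g.1.hom.functionFieldMap) ?_ 1 Scheme.Hom.functionFieldMap_id ?_ _ ?_
    fun g ↦ hx g g.2
  · obtain ⟨a, b, -, rfl⟩ := IsFractionRing.div_surjective (A := Γ(U, f ⁻¹ᵁ W)) x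
    exact ⟨_, ⟨a, rfl⟩, _, ⟨b, rfl⟩, rfl⟩
  · rintro g _ ⟨s, rfl⟩
    exact ⟨_, (hg g g.2 s).symm⟩
  · exact fun h ↦ ⟨Equiv.mulRight h, fun g x ↦
      (Scheme.Hom.functionFieldMap_comp h.1.hom g.1.hom x).symm⟩
  · rintro _ ⟨s, rfl⟩ hs
    obtain ⟨t, ht, -⟩ := hf.sections W s fun g hgG ↦
      FaithfulSMul.algebraMap_injective _ U.functionField ((hg g hgG s).symm.trans (hs ⟨g, hgG⟩))
    refine ⟨V.presheaf.germ W _ hη t, (f.functionFieldMap_germ W hη t).trans ?_⟩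
    exact congrArg _ ht

end GaloisCover

/-! ### Stalks of logarithmic forms -/

section LogForms

namespace LogSym

theorem algebraMap_mem_logUnits {X : Scheme.{0}} [IsIntegral X] {W : X.Opens} {x : X} {z : X.presheaf.stalk x} (hz0 : z ≠ 0)
    (hz : ∀ p : Spec (X.presheaf.stalk x), X.fromSpecStalk x p ∈ W → z ∉ p.asIdeal) :
    algebraMap _ X.functionField z ∈ logUnits W x := by
  refine ⟨?_, ⟨z, rfl⟩, fun y hy hyW ↦ ?_⟩
  · rwa [Ne, map_eq_zero_iff _ (IsFractionRing.injective _ _)]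
  · have : y ∈ Set.range (X.fromSpecStalk x) := by rwa [Scheme.range_fromSpecStalk]
    obtain ⟨p, rfl⟩ := this
    exact inv_algebraMap_mem_localRing_fromSpecStalk x p (hz p hyW)

variable {X : Scheme.{0}} [X.Over SpecC] [IsIntegral X]

theorem repr_mem_of_mem_logFormsAt {W : X.Opens} {x : X} {ι : Type}
    (b : Module.Basis ι X.functionField (RatForm X)) {C : Subring X.functionField}
    (hC : localRing x ≤ C)
    (hD : ∀ z ∈ localRing x, ∀ j, b.repr (KaehlerDifferential.D ℂ X.functionField z) j ∈ C)
    (hlog : ∀ u ∈ logUnits W x, ∀ j,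
      u⁻¹ * b.repr (KaehlerDifferential.D ℂ X.functionField u) j ∈ C) :
    ∀ ω ∈ logFormsAt W x, ∀ j, b.repr ω j ∈ C := by
  intro ω hω j
  induction hω using Submodule.span_induction with
  | mem ω hω =>
    obtain ⟨z, hz, rfl⟩ | ⟨u, hu, rfl⟩ := hω
    · exact hD z hz j
    · rw [map_smul, Finsupp.smul_apply, smul_eq_mul]
      exact hlog u hu j
  | zero => rw [map_zero]; exact C.zero_mem
  | add ω ω' _ _ h h' => rw [map_add]; exact C.add_mem h h'
  | smul a ω _ h =>
    have h1 : a • ω = (a : X.functionField) • ω := rfl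
    rw [h1, map_smul, Finsupp.smul_apply, smul_eq_mul]
    exact C.mul_mem (hC a.2) h

theorem smul_mem_logFormsAt {W : X.Opens} {x : X} (a : X.presheaf.stalk x) {ω : RatForm X}
    (hω : ω ∈ logFormsAt W x) : algebraMap _ X.functionField a • ω ∈ logFormsAt W x :=
  (logFormsAt W x).smul_mem (⟨_, ⟨a, rfl⟩⟩ : localRing x) hω

theorem mem_logFormsAt_of_mem_span {W : X.Opens} {x : X} {ω : RatForm X}
    (hω : ω ∈ Submodule.span (X.presheaf.stalk x) (Set.range fun a : X.presheaf.stalk x ↦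
      KaehlerDifferential.D ℂ X.functionField (algebraMap _ X.functionField a))) :
    ω ∈ logFormsAt W x := by
  induction hω using Submodule.span_induction with
  | mem ω hω =>
    obtain ⟨a, rfl⟩ := hω
    exact Submodule.subset_span (.inl ⟨_, ⟨a, rfl⟩, rfl⟩)
  | zero => exact zero_mem _
  | add ω ω' _ _ h h' => exact add_mem h h'
  | smul a ω _ h =>
    rw [← algebraMap_smul X.functionField a ω]
    exact smul_mem_logFormsAt a h

/-- The local ring at a generization is a ring of fractions of the one at `x`, so the quotient rule
applies. -/
theorem derivation_mem_localRing_fromSpecStalk (δ : Derivation ℂ X.functionField X.functionField)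
    (x : X) (hδ : ∀ z ∈ localRing x, δ z ∈ localRing x) (p : Spec (X.presheaf.stalk x))
    {c : X.functionField} (hc : c ∈ localRing (X.fromSpecStalk x p)) :
    δ c ∈ localRing (X.fromSpecStalk x p) := by
  obtain ⟨a, s, hs, h⟩ := exists_eq_div_of_mem_localRing_fromSpecStalk x p hc
  have hs' := inv_algebraMap_mem_localRing_fromSpecStalk x p hs
  have hle := localRing_le_of_specializes (fromSpecStalk_specializes x p)
  have hs0 : algebraMap _ X.functionField s ≠ 0 := by
    rw [Ne, map_eq_zero_iff _ (IsFractionRing.injective _ _)]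
    rintro rfl
    exact hs p.asIdeal.zero_mem
  have h1 : δ c = (algebraMap _ X.functionField s)⁻¹ *
      (δ (algebraMap _ X.functionField a) - c * δ (algebraMap _ X.functionField s)) := by
    rw [← h, δ.leibniz, smul_eq_mul, smul_eq_mul]
    field_simp
    ring
  rw [h1]
  exact mul_mem hs' (sub_mem (hle (hδ _ ⟨a, rfl⟩)) (mul_mem hc (hle (hδ _ ⟨s, rfl⟩))))

end LogSym

end LogForms

/-! ### Regularity of the norm -/

section Descent

namespace LogSym

variable {U X Y : Scheme.{0}} [X.Over SpecC] [Y.Over SpecC] [IsIntegral U] [IsIntegral X]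
  [IsIntegral Y] [Algebra Y.functionField X.functionField]
  [IsScalarTower ℂ Y.functionField X.functionField]
  [Algebra.FormallyEtale Y.functionField X.functionField] {ι : Type}
  (e : Module.Basis ι Y.functionField (RatForm Y))

/-- On `U` there is no boundary: logarithmic units are units, so it suffices that the dual
derivations preserve the local ring. This passes from `h u` to `u` because `h` is unramified. -/
theorem coeff_mem_localRing_of_etale (i : U ⟶ X) [IsOpenImmersion i] (h : U ⟶ Y) [IsDominant h]
    [FormallyUnramified h]
    (hih : ∀ x, i.functionFieldMap (algebraMap Y.functionField X.functionField x) =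
      h.functionFieldMap x) (u : U)
    (he : ∀ c ∈ localRing (h u), ∀ j,
      e.repr (KaehlerDifferential.D ℂ Y.functionField c) j ∈ localRing (h u))
    {k : ℕ} {σ : RatSymForm X} (hσ : σ ∈ logSymFormsAt i.opensRange k (i u)) (m : ι →₀ ℕ) :
    (SymmetricAlgebra.equivMvPolynomial
      (e.kaehlerOfFormallyEtale (L := X.functionField)) σ).coeff m ∈ localRing (i u) := by
  have hδ (j : ι) (x : X.functionField) (hx : x ∈ localRing (i u)) :
      e.kaehlerDerivation j x ∈ localRing (i u) := by
    rw [← i.functionFieldMap_mem_localRing_iff] at hx ⊢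
    refine h.derivation_mem_localRing u i.functionFieldEquiv (e.kaehlerDerivation j)
      (fun c hc ↦ ?_) hx
    rw [← hih, ← i.functionFieldEquiv_apply, RingEquiv.symm_apply_apply,
      Module.Basis.kaehlerDerivation_algebraMap, i.functionFieldEquiv_apply, hih]
    exact h.functionFieldMap_mem_localRing u (he c hc j)
  refine SymmetricAlgebra.coeff_mem_of_mem_span _ le_rfl
    (repr_mem_of_mem_logFormsAt _ le_rfl (fun z hz j ↦ hδ j z hz) fun v hv j ↦ ?_) hσ m
  exact mul_mem (hv.2.2 _ specializes_rfl ⟨u, rfl⟩) (hδ j v hv.2.1)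

/-- Let `x` be the center on `X` of the pullback `C` of `B` by `γ`. The dual derivations commute
with `γ`, so they are logarithmic on `C` as well. They then have values in `C` on `dz` and on `du /
u` for all `z` and nonzero `u` regular at `x`, whether or not `u` is a unit; the shape of the
boundary at `x` plays no role. -/
theorem algEquiv_coeff_mem_valuationSubring [UniversallyClosed (X ↘ SpecC)]
    (B : ValuationSubring X.functionField) (hB : ∀ c : ℂ, algebraMap ℂ X.functionField c ∈ B)
    (hlog : ∀ j, ∀ b ∈ B, b ≠ 0 → e.kaehlerDerivation (L := X.functionField) (k := ℂ) j b / b ∈ B)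
    (γ : X.functionField ≃ₐ[Y.functionField] X.functionField) {W : X.Opens}
    {k : ℕ} {σ : RatSymForm X} (hσ : ∀ x, σ ∈ logSymFormsAt W k x) (m : ι →₀ ℕ) :
    γ ((SymmetricAlgebra.equivMvPolynomial
      (e.kaehlerOfFormallyEtale (L := X.functionField)) σ).coeff m) ∈ B := by
  let C : ValuationSubring X.functionField := B.comap (γ : X.functionField →+* X.functionField)
  obtain ⟨x, hx⟩ := exists_localRing_le C fun c ↦ by
    change γ _ ∈ B
    rw [IsScalarTower.algebraMap_apply ℂ Y.functionField X.functionField, γ.commutes,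
      ← IsScalarTower.algebraMap_apply]
    exact hB c
  have hδ (j : ι) (b : X.functionField) (hb : b ∈ C) (hb0 : b ≠ 0) :
      b⁻¹ * e.kaehlerDerivation j b ∈ C := by
    change γ _ ∈ B
    rw [map_mul, map_inv₀, ← Module.Basis.kaehlerDerivation_algEquiv, mul_comm, ← div_eq_mul_inv]
    exact hlog j _ hb (by simpa using hb0)
  refine SymmetricAlgebra.coeff_mem_of_mem_span _ hx
    (repr_mem_of_mem_logFormsAt _ hx (fun z hz j ↦ ?_)
      fun v hv j ↦ hδ j v (hx hv.2.1) hv.1) (hσ x) m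
  by_cases hz0 : z = 0
  · rw [hz0, map_zero, map_zero]
    exact C.zero_mem
  · rw [← Module.Basis.kaehlerDerivation_apply, ← mul_inv_cancel_left₀ hz0
      (e.kaehlerDerivation (L := X.functionField) j z)]
    exact C.mul_mem _ _ (hx hz) (hδ j z (hx hz) hz0)

theorem coeff_mem_localRing_of_map_eq_prod [UniversallyClosed (X ↘ SpecC)] [Smooth (Y ↘ SpecC)]
    [FiniteDimensional Y.functionField X.functionField]
    (i : U ⟶ X) [IsOpenImmersion i] (h : U ⟶ Y) [IsDominant h] [Etale h]
    (hih : ∀ x, i.functionFieldMap (algebraMap Y.functionField X.functionField x) =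
      h.functionFieldMap x)
    {G : Type} [Fintype G] (α : G → Aut U) (hα : ∀ g, (α g).hom ≫ h = h)
    (γ : G → X.functionField ≃ₐ[Y.functionField] X.functionField)
    (hγ : ∀ g x, i.functionFieldMap (γ g x) =
      (α g).hom.functionFieldMap (i.functionFieldMap x))
    {k : ℕ} {σ : RatSymForm X} (hσ : ∀ x, σ ∈ logSymFormsAt i.opensRange k x)
    (y : Y) {d : ℕ} (z : Fin d → Y.presheaf.stalk y) (s : Finset (Fin d))
    (hz : ∀ l ∈ s, Prime (z l))
    (hs : ∀ p : Spec (Y.presheaf.stalk y), (∀ l ∈ s, z l ∉ p.asIdeal) →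
      Y.fromSpecStalk y p ∈ Set.range h)
    (he : ∀ (a : Y.presheaf.stalk y) j, ∃ a' : Y.presheaf.stalk y,
      e.repr (KaehlerDifferential.D ℂ Y.functionField (algebraMap _ Y.functionField a)) j =
        algebraMap _ Y.functionField a')
    (hes : ∀ l ∈ s, ∀ j, ∃ a' : Y.presheaf.stalk y,
      e.repr (KaehlerDifferential.D ℂ Y.functionField (algebraMap _ Y.functionField (z l))) j =
        algebraMap _ Y.functionField (z l * a'))
    {τ : RatSymForm Y}
    (hτ : MvPolynomial.map (algebraMap Y.functionField X.functionField)
      (SymmetricAlgebra.equivMvPolynomial e τ) =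
        ∏ g, MvPolynomial.map (γ g : X.functionField →+* X.functionField)
          (SymmetricAlgebra.equivMvPolynomial
            (e.kaehlerOfFormallyEtale (L := X.functionField)) σ)) (m : ι →₀ ℕ) :
    (SymmetricAlgebra.equivMvPolynomial e τ).coeff m ∈ localRing y := by
  have hcoeff (C : Subring X.functionField) (hC : ∀ g m, γ g ((SymmetricAlgebra.equivMvPolynomial
      (e.kaehlerOfFormallyEtale (L := X.functionField)) σ).coeff m) ∈ C) :
      algebraMap _ X.functionField ((SymmetricAlgebra.equivMvPolynomial e τ).coeff m) ∈ C := by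
    rw [← MvPolynomial.coeff_map, hτ]
    refine MvPolynomial.coeff_prod_mem C _ _ (fun g _ m ↦ ?_) m
    rw [MvPolynomial.coeff_map]
    exact hC g m
  refine IsFractionRing.exists_algebraMap_eq_of_prime _ s z hz (fun p hp hps ↦ ?_) fun l hl ↦ ?_
  -- Off the boundary, regularity is tested at a point `u` above the given one, and each conjugate
  -- at `u` is tested at the translate of `u` by `α g`, which lies over the same point.
  · let P : Spec (Y.presheaf.stalk y) := ⟨p, hp⟩
    obtain ⟨u, hu⟩ := hs P hps
    refine exists_eq_div_of_mem_localRing_fromSpecStalk y P ?_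
    rw [← hu, ← h.functionFieldMap_mem_localRing_iff_of_flat, ← hih]
    refine hcoeff ((localRing u).comap i.functionFieldMap) fun g m ↦ ?_
    rw [Subring.mem_comap, hγ]
    refine (α g).hom.functionFieldMap_mem_localRing u ?_
    rw [i.functionFieldMap_mem_localRing_iff]
    refine coeff_mem_localRing_of_etale e i h hih _ ?_ (hσ _) m
    rw [← Scheme.Hom.comp_apply, hα, hu]
    intro c hc j
    refine derivation_mem_localRing_fromSpecStalk
      ((e.coord j).compDer (KaehlerDifferential.D ℂ Y.functionField)) y ?_ P hc
    rintro _ ⟨a, rfl⟩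
    obtain ⟨a', ha'⟩ := he a j
    exact ⟨a', ha'.symm⟩
  -- Along `z l`, regularity is tested in the valuation ring `B`, which contains all conjugates of
  -- the coefficients.
  · let _ := ((algebraMap Y.functionField X.functionField).comp
      (algebraMap (Y.presheaf.stalk y) Y.functionField)).toAlgebra
    let _ : Algebra ℚ (Y.presheaf.stalk y) := Algebra.compHom _ (algebraMap ℚ ℂ)
    have : IsScalarTower (Y.presheaf.stalk y) Y.functionField X.functionField :=
      .of_algebraMap_eq fun _ ↦ rfl
    have : CharZero Y.functionField :=
      charZero_of_injective_algebraMap (algebraMap ℂ Y.functionField).injective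
    obtain ⟨B, hAB, hBK, hB⟩ := (hz l hl).exists_valuationSubring_derivation_div_mem ℂ
      Y.functionField X.functionField
    refine hBK _ (hcoeff B.toSubring fun g m ↦ ?_)
    refine algEquiv_coeff_mem_valuationSubring e B (fun c ↦ ?_) (fun j ↦ hB _ (fun a ↦ ?_) ?_)
      (γ g) hσ m
    · rw [IsScalarTower.algebraMap_apply ℂ Y.functionField X.functionField,
        IsScalarTower.algebraMap_apply ℂ (Y.presheaf.stalk y) Y.functionField]
      exact hAB _
    · obtain ⟨a', ha'⟩ := he a j
      refine ⟨a', (e.kaehlerDerivation_algebraMap j _).trans ?_⟩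
      rw [ha']
      rfl
    · obtain ⟨a', ha'⟩ := hes l hl j
      refine ⟨a', (e.kaehlerDerivation_algebraMap j _).trans ?_⟩
      rw [ha']
      rfl

end LogSym

end Descent

/-! ### The Galois action on the function field of the compactification, and the conclusion -/

/-- Neither `f` nor the action of `G` need extend to the compactifications, but both act on function
fields, which do not change under `i` and `j`. -/
theorem LogSym.exists_algebra_functionField {U V X Y : Scheme.{0}} [U.Over SpecC] [V.Over SpecC]
    [X.Over SpecC] [Y.Over SpecC] [IsIntegral U] [IsIntegral V] [IsIntegral X] [IsIntegral Y]
    (f : U ⟶ V) [IsDominant f] [IsFinite f] (hf_over : f.IsOver SpecC) {G : Subgroup (Aut U)}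
    [Finite G] (hG : IsQuotientBy G f) (i : U ⟶ X) [IsOpenImmersion i] (hi : i.IsOver SpecC)
    (j : V ⟶ Y) [IsOpenImmersion j] (hj : j.IsOver SpecC) :
    ∃ (_ : Algebra Y.functionField X.functionField)
      (γ : G → X.functionField ≃ₐ[Y.functionField] X.functionField),
      IsScalarTower ℂ Y.functionField X.functionField ∧
      FiniteDimensional Y.functionField X.functionField ∧
      (∀ x, i.functionFieldMap (algebraMap Y.functionField X.functionField x) =
        (f ≫ j).functionFieldMap x) ∧
      (∀ (g : G) x, i.functionFieldMap (γ g x) =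
        g.1.hom.functionFieldMap (i.functionFieldMap x)) ∧
      ∀ x, (∀ g, γ g x = x) → ∃ c, algebraMap Y.functionField X.functionField c = x := by
  let E := i.functionFieldEquiv
  let φ : Y.functionField →+* X.functionField :=
    (E.symm : U.functionField →+* X.functionField).comp (f ≫ j).functionFieldMap
  have hφ (x : Y.functionField) : i.functionFieldMap (φ x) = (f ≫ j).functionFieldMap x :=
    E.apply_symm_apply _
  have hinv (g : G) (x : Y.functionField) :
      g.1.hom.functionFieldMap ((f ≫ j).functionFieldMap x) = (f ≫ j).functionFieldMap x := by
    rw [← Scheme.Hom.functionFieldMap_comp]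
    refine Scheme.Hom.functionFieldMap_congr ?_ x
    rw [← Category.assoc, hG.invariant g.1 g.2]
  let _ : Algebra Y.functionField X.functionField := φ.toAlgebra
  let γ (g : G) : X.functionField ≃ₐ[Y.functionField] X.functionField :=
    AlgEquiv.ofRingEquiv (f := (E.trans g.1.hom.functionFieldEquiv).trans E.symm) fun x ↦ by
      refine E.injective ((E.apply_symm_apply _).trans ?_)
      change g.1.hom.functionFieldMap (i.functionFieldMap (φ x)) = i.functionFieldMap (φ x)
      rw [hφ, hinv]
  have hγ (g : G) (x : X.functionField) : i.functionFieldMap (γ g x) =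
      g.1.hom.functionFieldMap (i.functionFieldMap x) := E.apply_symm_apply _
  refine ⟨inferInstance, γ, .of_algebraMap_eq fun c ↦ E.injective ?_, ?_, hφ, hγ, fun x hx ↦ ?_⟩
  · have : (f ≫ j).IsOver SpecC := inferInstance
    refine (i.functionFieldMap_algebraMap_complex hi c).trans ?_
    refine ((f ≫ j).functionFieldMap_algebraMap_complex this c).symm.trans (hφ _).symm
  · have h1 : φ = (E.symm : U.functionField →+* X.functionField).comp
        (f.functionFieldMap.comp (j.functionFieldEquiv : Y.functionField →+* V.functionField)) :=
      RingHom.ext fun x ↦ congrArg E.symm (f.functionFieldMap_comp j x)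
    have h2 : φ.Finite := by
      rw [h1]
      exact (RingHom.Finite.of_surjective _ E.symm.surjective).comp
        (f.functionFieldMap_finite.comp (RingHom.Finite.of_surjective _
          j.functionFieldEquiv.surjective))
    exact h2
  · obtain ⟨c, hc⟩ := hG.mem_range_functionFieldMap (x := i.functionFieldMap x) fun g hg ↦ by
      rw [← hγ ⟨g, hg⟩, hx]
    obtain ⟨c, rfl⟩ := j.functionFieldMap_bijective.2 c
    refine ⟨c, E.injective ((hφ c).trans ?_)⟩
    rw [Scheme.Hom.functionFieldMap_comp]
    exact hc

theorem LogSym.mem_logSymForms_top {X : Scheme.{0}} [X.Over SpecC] [IsIntegral X] {W : X.Opens}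
    {k : ℕ} {σ : RatSymForm X} :
    σ ∈ logSymForms W k ⊤ ↔ ∀ x, σ ∈ logSymFormsAt W k x := by
  simp [logSymForms]

theorem lemma4p5
    (U V : Scheme.{0}) [U.Over SpecC] [V.Over SpecC]
    (hU : IsQuasiProjectiveManifold U) (hV : IsQuasiProjectiveManifold V)
    (f : U ⟶ V) (hf_over : f.IsOver SpecC) (hf_finite : IsFinite f) (hf_etale : Etale f)
    (hf_galois : IsGaloisCover f)
    (X : Scheme.{0}) [X.Over SpecC] [IsIntegral X] (i : U ⟶ X) [IsOpenImmersion i]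
    (hi : IsSNCCompactification i)
    (Y : Scheme.{0}) [Y.Over SpecC] [IsIntegral Y] (j : V ⟶ Y) [IsOpenImmersion j]
    (hj : IsSNCCompactification j)
    (hlog : ∃ k : ℕ, 0 < k ∧ HasNonzeroLogSymForm i.opensRange k) :
    ∃ m : ℕ, 0 < m ∧ HasNonzeroLogSymForm j.opensRange m := by
  have := hU.isIntegral
  have := hV.isIntegral
  have := hj.smooth
  have := hi.projective.universallyClosed
  obtain ⟨G, hGfin, hG⟩ := hf_galois
  have := Fintype.ofFinite G
  have hsurj : Function.Surjective f := hG.isQuotientMap.surjective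
  have : IsDominant f := ⟨hsurj.denseRange⟩
  obtain ⟨k, hk, σ, hσ, hσ0⟩ := hlog
  rw [mem_logSymForms_top] at hσ
  obtain ⟨_, γ, _, _, hih, hγ, hfix⟩ :=
    exists_algebra_functionField f hf_over hG i hi.isOver j hj.isOver
  have : CharZero Y.functionField :=
    charZero_of_injective_algebraMap (algebraMap ℂ Y.functionField).injective
  have : Algebra.FormallyEtale Y.functionField X.functionField :=
    Algebra.FormallyEtale.of_isSeparable _ _
  have hperm (a : G) : ∃ π : G ≃ G, ∀ g x, γ a (γ g x) = γ (π g) x := by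
    -- Pullback of functions is contravariant, hence multiplication on the right.
    refine ⟨Equiv.mulRight a, fun g x ↦ i.functionFieldMap.injective ?_⟩
    rw [hγ, hγ, hγ]
    exact (Scheme.Hom.functionFieldMap_comp a.1.hom g.1.hom _).symm
  obtain ⟨τ, hτ0, hτ⟩ :=
    SymmetricAlgebra.exists_map_equivMvPolynomial_eq_prod (k := ℂ) γ hperm hfix σ hσ0
  -- The norm has one factor of degree `k` for each element of `G`.
  refine ⟨Fintype.card G * k, Nat.mul_pos Fintype.card_pos hk, τ, ?_, hτ0⟩
  rw [mem_logSymForms_top]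
  intro y
  obtain ⟨d, z, s, hdim, hspan, hsnc⟩ := hj.snc y
  have hprime := IsLocalRing.prime_of_span_eq_maximalIdeal z hspan hdim
  obtain ⟨ι, _, e, he, hes, heW⟩ := IsLocalRing.exists_basis_log ℂ Y.functionField z hspan hdim s
  refine SymmetricAlgebra.mem_span_of_coeff_mem e (fun l ↦ ?_) ?_ fun m ↦ ?_
  · obtain h | ⟨l', hl', h⟩ := heW l
    · exact mem_logFormsAt_of_mem_span h
    · refine Submodule.subset_span (.inr ⟨_, algebraMap_mem_logUnits (hprime l').ne_zero
        fun p hp ↦ (hsnc p).mp hp l' hl', h⟩)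
  · refine MvPolynomial.IsHomogeneous.of_map
      (algebraMap Y.functionField X.functionField).injective ?_
    rw [hτ e]
    simpa using MvPolynomial.IsHomogeneous.prod Finset.univ _ (fun _ ↦ k) fun g _ ↦
      (SymmetricAlgebra.isHomogeneous_of_mem_span (e.kaehlerOfFormallyEtale)
        -- Homogeneity can be read off at any point of `X`; the generic one is at hand.
        (hσ (genericPoint X))).map _
  · refine coeff_mem_localRing_of_map_eq_prod e i (f ≫ j) hih (fun g : G ↦ g.1) (fun g ↦ ?_) γ hγ
      hσ y z s (fun l _ ↦ hprime l) (fun p hp ↦ ?_) he hes (hτ e) m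
    · rw [← Category.assoc, hG.invariant g.1 g.2]
    -- Where no boundary equation vanishes, the point lies in `V`, and `f` is surjective.
    · obtain ⟨v, hv⟩ := (hsnc p).mpr hp
      obtain ⟨u, rfl⟩ := hsurj v
      exact ⟨u, by rw [Scheme.Hom.comp_apply]; exact hv⟩
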